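/- Let $m\ge 1$. A model of $T_m$ is a set $D$ with a function $\mathrm{Sel}$ that assigns to every finite $X\subseteq D$ with $|X|>m$ an $m$-element subset $\mathrm{Sel}(X)\subseteq X$; submodels and isomorphisms are defined in the obvious way. A model $\mathbf F$ of $T_m$ with domain $\omega$ is called generic if every non-empty finite model of $T_m$ is isomorphic to infinitely many submodels of $\mathbf F$ and every isomorphism between two finite submodels of $\mathbf F$ extends to an automorphism of $\mathbf F$. Given a generic $\mathbf F$, let $\mathrm{MOD}_m$ be the permutation model of set theory with atoms whose atoms are the elements of $\mathbf F$, whose group is $G=\mathrm{Aut}(\mathbf F)$, and whose normal ideal consists of the finite sets of atoms. Thus $\mathrm{MOD}_m$ consists of all hereditarily symmetric objects, where $x$ is symmetric if some finite set $S$ of atoms supports it, that is, $\pi x=x$ for every $\pi$ in the pointwise stabilizer $\mathrm{fix}_G(S)$. For a natural number $n$ let $n\mathrm{RC_{fin}}$ be the statement: every infinite set $x$ has an infinite subset $y$ with a function $f\colon[y]^{>n}\to[y]^n$ such that $f(z)\subseteq z$ for all $z\in[y]^{>n}$; here $[y]^{>n}$ is the set of finite subsets of $y$ with more than $n$ elements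 and $[y]^n$ is the set of $n$-element subsets of $y$. **Theorem.** Let $n>m\ge 1$ be integers such that $n$ is not a multiple of $m$. A generic model of $T_m$ with domain $\omega$ exists, and for every such model the following hold. 1. $\mathrm{MOD}_m\not\models n\mathrm{RC_{fin}}$. 2. More precisely, $n\mathrm{RC_{fin}}$ fails in $\mathrm{MOD}_m$ for the set $x$ of all atoms: in $\mathrm{MOD}_m$, no infinite set $y$ of atoms has a function $f\colon[y]^{>n}\to[y]^n$ with $f(z)\subseteq z$ for all $z\in[y]^{>n}$. 3. If $S$ is a finite set of atoms, $Y$ is an infinite set of atoms supported by $S$, and $k\in\omega$, then there are $mk$ distinct elements of $Y\setminus S$ and a $\pi\in\mathrm{fix}_G(S)$ that acts on these elements as a product of $k$ disjoint $m$-cycles. 4. $\mathrm{MOD}_m\models m\mathrm{RC_{fin}}$. Hence, by 1, $\mathrm{MOD}_m$ is a permutation model in which $m\mathrm{RC_{fin}}$ holds and $n\mathrm{RC_{fin}}$ fails, so that $m\mathrm{RC_{fin}}$ does not imply $n\mathrm{RC_{fin}}$ in set theory with atoms. -/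

import Mathlib

universe u

/-! ## The universe of sets over a type of atoms -/

/-- Codes for the sets (with atoms) over the type `A` of atoms: a code is an atom or an indexed
family of codes. -/
inductive PreAtomSet (A : Type u) : Type (u + 1)
  | atom (a : A) : PreAtomSet A
  | mk (ι : Type u) (f : ι → PreAtomSet A) : PreAtomSet A

namespace PreAtomSet

variable {A : Type u}

/-- Extensional equality of codes. An atom is equal to itself only. -/
def Equiv : PreAtomSet A → PreAtomSet A → Prop
  | atom a, atom b => a = b
  | mk _ f, mk _ g => (∀ i, ∃ j, Equiv (f i) (g j)) ∧ ∀ j, ∃ i, Equiv (f i) (g j)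
  | atom _, mk _ _ => False
  | mk _ _, atom _ => False

theorem Equiv.refl : ∀ x : PreAtomSet A, Equiv x x
  | atom _ => rfl
  | mk _ f => ⟨fun i => ⟨i, Equiv.refl (f i)⟩, fun i => ⟨i, Equiv.refl (f i)⟩⟩

theorem Equiv.symm : ∀ {x y : PreAtomSet A}, Equiv x y → Equiv y x
  | atom _, atom _, h => Eq.symm h
  | mk _ _, mk _ _, h =>
    ⟨fun j => (h.2 j).imp fun _ hi => Equiv.symm hi,
      fun i => (h.1 i).imp fun _ hj => Equiv.symm hj⟩
  | atom _, mk _ _, h => h.elim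
  | mk _ _, atom _, h => h.elim

theorem Equiv.trans : ∀ {x y z : PreAtomSet A}, Equiv x y → Equiv y z → Equiv x z
  | atom _, atom _, atom _, h, h' => Eq.trans h h'
  | mk _ _, mk _ _, mk _ _, h, h' =>
    ⟨fun i => let ⟨j, hj⟩ := h.1 i; let ⟨k, hk⟩ := h'.1 j; ⟨k, Equiv.trans hj hk⟩,
      fun k => let ⟨j, hj⟩ := h'.2 k; let ⟨i, hi⟩ := h.2 j; ⟨i, Equiv.trans hi hj⟩⟩
  | atom _, mk _ _, _, h, _ => h.elim
  | mk _ _, atom _, _, h, _ => h.elim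
  | atom _, atom _, mk _ _, _, h => h.elim
  | mk _ _, mk _ _, atom _, _, h => h.elim

instance setoid (A : Type u) : Setoid (PreAtomSet A) :=
  ⟨Equiv, Equiv.refl, Equiv.symm, Equiv.trans⟩

/-- Membership of codes. Atoms have no elements. -/
def Mem (x : PreAtomSet A) : PreAtomSet A → Prop
  | atom _ => False
  | mk _ f => ∃ i, Equiv x (f i)

theorem Mem.congr {x x' : PreAtomSet A} (hx : Equiv x x') :
    ∀ {y y' : PreAtomSet A}, Equiv y y' → (Mem x y ↔ Mem x' y')
  | atom _, atom _, _ => Iff.rfl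
  | mk _ _, mk _ _, h =>
    ⟨fun ⟨i, hi⟩ => let ⟨j, hj⟩ := h.1 i; ⟨j, (hx.symm.trans hi).trans hj⟩,
      fun ⟨j, hj⟩ => let ⟨i, hi⟩ := h.2 j; ⟨i, (hx.trans hj).trans hi.symm⟩⟩
  | atom _, mk _ _, h => h.elim
  | mk _ _, atom _, h => h.elim

/-- The code is an atom. -/
def IsAtom : PreAtomSet A → Prop
  | atom _ => True
  | mk _ _ => False

theorem IsAtom.congr : ∀ {x y : PreAtomSet A}, Equiv x y → (IsAtom x ↔ IsAtom y)
  | atom _, atom _, _ => Iff.rfl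
  | mk _ _, mk _ _, _ => Iff.rfl
  | atom _, mk _ _, h => h.elim
  | mk _ _, atom _, h => h.elim

/-- The action of a permutation of the atoms on codes. -/
def perm (π : Equiv.Perm A) : PreAtomSet A → PreAtomSet A
  | atom a => atom (π a)
  | mk ι f => mk ι fun i => perm π (f i)

theorem perm_congr (π : Equiv.Perm A) :
    ∀ {x y : PreAtomSet A}, Equiv x y → Equiv (perm π x) (perm π y)
  | atom _, atom _, h => congrArg π h
  | mk _ _, mk _ _, h =>
    ⟨fun i => (h.1 i).imp fun _ hj => perm_congr π hj,
      fun j => (h.2 j).imp fun _ hi => perm_congr π hi⟩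
  | atom _, mk _ _, h => h.elim
  | mk _ _, atom _, h => h.elim

end PreAtomSet

/-- The universe `V(A)` of all sets with atoms from `A` (a model of ZFA with choice). -/
def AtomSet (A : Type u) : Type (u + 1) :=
  Quotient (PreAtomSet.setoid A)

namespace AtomSet

variable {A : Type u}

/-- The atom `a` as an element of `V(A)`. -/
def atom (a : A) : AtomSet A :=
  Quotient.mk _ (PreAtomSet.atom a)

/-- The set of all atoms. -/
def atoms (A : Type u) : AtomSet A :=
  Quotient.mk _ (PreAtomSet.mk A PreAtomSet.atom)

/-- Membership in `V(A)`. -/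
def Mem : AtomSet A → AtomSet A → Prop :=
  Quotient.lift₂ PreAtomSet.Mem fun _ _ _ _ hx hy => propext (PreAtomSet.Mem.congr hx hy)

/-- `x` is an atom. -/
def IsAtom : AtomSet A → Prop :=
  Quotient.lift PreAtomSet.IsAtom fun _ _ h => propext (PreAtomSet.IsAtom.congr h)

/-- The action of a permutation of the atoms on `V(A)`: `π x = {π y : y ∈ x}` for sets `x`. -/
def perm (π : Equiv.Perm A) : AtomSet A → AtomSet A :=
  Quotient.map (PreAtomSet.perm π) fun _ _ h => PreAtomSet.perm_congr π h

/-- The pointwise stabilizer `fix_G(S)` of a set `S` of atoms. -/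
def fixing (G : Subgroup (Equiv.Perm A)) (S : Set A) : Set (Equiv.Perm A) :=
  {π | π ∈ G ∧ ∀ a ∈ S, π a = a}

/-- `S` is a support of `x`: every member of `fix_G(S)` maps `x` to itself. -/
def Supports (G : Subgroup (Equiv.Perm A)) (S : Set A) (x : AtomSet A) : Prop :=
  ∀ π ∈ fixing G S, perm π x = x

/-- `x` is hereditarily symmetric with respect to `G` and the normal ideal of finite sets of atoms:
`x` has a finite support, and so has every element of its transitive closure. -/
inductive HereditarilySymmetric (G : Subgroup (Equiv.Perm A)) : AtomSet A → Prop
  | intro (x : AtomSet A) (hx : ∃ S : Finset A, Supports G (S : Set A) x)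
      (h : ∀ y, Mem y x → HereditarilySymmetric G y) : HereditarilySymmetric G x

theorem hereditarilySymmetric_atom (G : Subgroup (Equiv.Perm A)) (a : A) :
    HereditarilySymmetric G (atom a) := by
  refine .intro _ ⟨{a}, fun π hπ => ?_⟩ ?_
  · exact congrArg atom (hπ.2 a (by simp))
  · intro y
    refine Quotient.inductionOn y fun y h => ?_
    exact False.elim h

theorem hereditarilySymmetric_atoms (G : Subgroup (Equiv.Perm A)) :
    HereditarilySymmetric G (atoms A) := by
  refine .intro _ ⟨∅, fun π _ => ?_⟩ ?_
  · exact Quotient.sound ⟨fun a => ⟨π a, rfl⟩, fun a => ⟨π.symm a, π.apply_symm_apply a⟩⟩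
  · intro y
    refine Quotient.inductionOn y fun y h => ?_
    obtain ⟨a, ha⟩ := h
    have h' : (Quotient.mk _ y : AtomSet A) = atom a := Quotient.sound ha
    rw [h']
    exact hereditarilySymmetric_atom G a

end AtomSet

/-! ## Set structures with atoms, and the choice principle -/

/-- A structure for the language of set theory with atoms. -/
structure SetStructure where
  /-- the objects: sets and atoms -/
  Obj : Type u
  /-- the membership relation -/
  mem : Obj → Obj → Prop
  /-- the predicate of being an atom -/
  isAtom : Obj → Prop

namespace SetStructure

variable (M : SetStructure.{u})

/-- The collection of the elements of `x`. -/
def ext (x : M.Obj) : Set M.Obj :=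
  {z | M.mem z x}

/-- `z` is a set, and a subset of `x`. -/
def Subset (z x : M.Obj) : Prop :=
  ¬ M.isAtom z ∧ ∀ t, M.mem t z → M.mem t x

/-- `z ∈ [y]^{>n}`: `z` is a finite subset of `y` with more than `n` elements.
(Finiteness and finite cardinality are absolute for permutation models, as these contain all
finite sets of their objects.) -/
def FinSubsetGT (n : ℕ) (z y : M.Obj) : Prop :=
  M.Subset z y ∧ (M.ext z).Finite ∧ n < (M.ext z).ncard

/-- `w ∈ [y]^n`: `w` is a subset of `y` with exactly `n` elements. -/
def SubsetCard (n : ℕ) (w y : M.Obj) : Prop :=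
  M.Subset w y ∧ (M.ext w).Finite ∧ (M.ext w).ncard = n

/-- `p` is the Kuratowski pair `(a, b) = {{a}, {a, b}}`. -/
def IsPair (p a b : M.Obj) : Prop :=
  ∃ s t, (∀ c, M.mem c s ↔ c = a) ∧ (∀ c, M.mem c t ↔ c = a ∨ c = b) ∧
    ∀ c, M.mem c p ↔ c = s ∨ c = t

/-- The pair `(a, b)` belongs to `f`. -/
def Maps (f a b : M.Obj) : Prop :=
  ∃ p, M.mem p f ∧ M.IsPair p a b

/-- `f` is a set of ordered pairs that is a function from the collection `D` to the
collection `C`. -/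
def IsFunction (f : M.Obj) (D C : M.Obj → Prop) : Prop :=
  ¬ M.isAtom f ∧ (∀ p, M.mem p f → ∃ a b, D a ∧ C b ∧ M.IsPair p a b) ∧
    ∀ a, D a → ∃! b, M.Maps f a b

/-- `x` has, in `M`, an infinite subset `y` with a function `f : [y]^{>n} → [y]^n` such that
`f(z) ⊆ z` for all `z ∈ [y]^{>n}`. -/
def HasPartialSelection (n : ℕ) (x : M.Obj) : Prop :=
  ∃ y, M.Subset y x ∧ (M.ext y).Infinite ∧
    ∃ f, M.IsFunction f (fun z => M.FinSubsetGT n z y) (fun w => M.SubsetCard n w y) ∧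
      ∀ z w, M.Maps f z w → M.Subset w z

/-- The principle `nRC_fin` holds in `M`. -/
def RCfin (n : ℕ) : Prop :=
  ∀ x, (M.ext x).Infinite → M.HasPartialSelection n x

end SetStructure

/-- The permutation model given by the type `A` of atoms, the group `G`, and the normal ideal of
finite sets of atoms. -/
def permutationModel {A : Type u} (G : Subgroup (Equiv.Perm A)) : SetStructure.{u + 1} where
  Obj := {x : AtomSet A // AtomSet.HereditarilySymmetric G x}
  mem x y := AtomSet.Mem x.1 y.1
  isAtom x := AtomSet.IsAtom x.1

/-- The set of all atoms as an object of the permutation model. -/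
def permutationModel.atoms {A : Type u} (G : Subgroup (Equiv.Perm A)) : (permutationModel G).Obj :=
  ⟨AtomSet.atoms A, AtomSet.hereditarilySymmetric_atoms G⟩

/-! ## The theory of selection functions and its generic countable model -/

/-- A model of `T_m` with domain `D`: a function `Sel` that selects an `m`-element subset from each
finite subset of `D` with more than `m` elements. The values of `Sel` on sets with at most `m`
elements carry no information and are ignored throughout. -/
structure SelModel (m : ℕ) (D : Type u) where
  /-- the selection function -/
  sel : Finset D → Finset D
  sel_subset : ∀ X, m < X.card → sel X ⊆ X
  card_sel : ∀ X, m < X.card → (sel X).card = m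

namespace SelModel

variable {m : ℕ}

/-- The injection `e` is an embedding of the model `M` into the model `F`. -/
def IsEmbedding {D : Type*} {E : Type*} (M : SelModel m D) (F : SelModel m E) (e : D ↪ E) : Prop :=
  ∀ X : Finset D, m < X.card → F.sel (X.map e) = (M.sel X).map e

/-- The automorphism group of a model of `T_m`. -/
def aut {D : Type*} (F : SelModel m D) : Subgroup (Equiv.Perm D) where
  carrier := {π | F.IsEmbedding F π.toEmbedding}
  one_mem' X _ := by
    change F.sel (X.map (Function.Embedding.refl D)) = (F.sel X).map (Function.Embedding.refl D)
    simp
  mul_mem' {π ρ} hπ hρ X hX := by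
    have h1 := hρ X hX
    have h2 := hπ (X.map ρ.toEmbedding) (by simpa using hX)
    rw [h1, Finset.map_map, Finset.map_map] at h2
    exact h2
  inv_mem' {π} hπ X hX := by
    have key : ∀ Z : Finset D, (Z.map (π⁻¹).toEmbedding).map π.toEmbedding = Z := by
      intro Z
      have e : (π⁻¹).toEmbedding.trans π.toEmbedding = Function.Embedding.refl D :=
        Function.Embedding.ext fun a => π.apply_symm_apply a
      rw [Finset.map_map, e, Finset.map_refl]
    have h := hπ (X.map (π⁻¹).toEmbedding) (by simpa using hX)
    rw [key] at h
    apply Finset.map_injective π.toEmbedding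
    rw [key, h]

/-- `F` is a generic (Fraïssé limit) model of `T_m` with domain `ω`: every non-empty finite model
of `T_m` is isomorphic to infinitely many submodels of `F`, and every isomorphism `e` between two
finite submodels of `F` (with domains `X` and `e(X)`) extends to an automorphism of `F`. -/
structure IsGeneric (F : SelModel m ℕ) : Prop where
  infinitely_many : ∀ (j : ℕ) (M : SelModel m (Fin j)), 0 < j →
    {N : Finset ℕ | ∃ e : Fin j ↪ ℕ, M.IsEmbedding F e ∧ Finset.univ.map e = N}.Infinite
  homogeneous : ∀ (X : Finset ℕ) (e : ℕ → ℕ), Set.InjOn e X →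
    (∀ Z ⊆ X, m < Z.card → F.sel (Z.image e) = (F.sel Z).image e) →
    ∃ π ∈ F.aut, ∀ x ∈ X, π x = e x

end SelModel

/-- The permutation model `MOD_m` over the generic model `F` of `T_m`: the atoms are the elements of
`F`, the group is the automorphism group of `F`, the ideal consists of the finite sets. -/
abbrev MOD {m : ℕ} (F : SelModel m ℕ) : SetStructure.{1} :=
  permutationModel F.aut

/-! Existence. Let every number `i` carry a finite "task" that prescribes selections from the finite
sets with maximum `i`, so that every finite list of prescriptions is the task of arbitrarily large
numbers. A one-point extension of a finite partial isomorphism is such a list, so it can be realized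
above any bound (`hasExtension_taskModel`), and back-and-forth gives homogeneity
(`HasExtension.exists_aut`).

Failure for `n`. Suppose `S` supports an infinite set `y` of atoms and a selection function `f` on
it, and let `a ∈ y` lie outside `S`. On `S` together with `k` copies of `ZMod m` there is a model of
`T_m` that is invariant under translation and in which every new point looks like `a` over `S`.
Embedding it over `S` yields `k` disjoint `m`-cycles of some `π ∈ fix(S)` inside the orbit of `a`,
hence inside `y` (`IsGeneric.exists_cycles`). With `k = n + 1`, the union `z` of the cycles is fixed
by `π`, and so is `f(z)`; thus `f(z)` is a union of `m`-cycles and `m ∣ n`. The invariant model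
exists because a stabilizer `H` of a finite set `Z` has order dividing `m` and acts freely on the
points of `Z` that the whole group does not fix: free orbits, filled up with fixed points if needed,
give an `H`-invariant set of size `m` (`exists_invariant_selModel`).

Success for `m`. If one finite set supports all elements of `x`, any selection function is
symmetric. Otherwise some `z ∈ x` is supported by `S ∪ {a}` but not by `S`, where `S` supports `x`.
Then `π z ↦ π a` is an equivariant bijection between the `fix(S)`-orbits of `z` and `a`, along which
`Sel` is transported. That it is well defined is the crux (`IsGeneric.apply_eq_of_smul_eq`) and
rests on amalgamation in the generic model. -/

namespace SelModel

variable {m : ℕ}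

/-! ### Finite partial isomorphisms, as relations symmetric in the two models -/

/-- The finite relation `p` is an isomorphism between a finite submodel of `M` and a finite
submodel of `N`. -/
def IsPartialIso {D E : Type*} [DecidableEq D] [DecidableEq E] (M : SelModel m D) (N : SelModel m E)
    (p : Finset (D × E)) : Prop :=
  (∀ q ∈ p, ∀ r ∈ p, q.1 = r.1 ↔ q.2 = r.2) ∧
    ∀ Z ⊆ p, m < Z.card →
      ∀ q ∈ Z, q.1 ∈ M.sel (Z.image Prod.fst) ↔ q.2 ∈ N.sel (Z.image Prod.snd)

section PartialIso

variable {D E : Type*} [DecidableEq D] [DecidableEq E] {M : SelModel m D} {N : SelModel m E}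
  {p : Finset (D × E)}

theorem isPartialIso_empty : IsPartialIso M N ∅ := by
  refine ⟨by simp, fun Z hZ hm => ?_⟩
  rw [Finset.subset_empty.1 hZ] at hm
  simp at hm

theorem IsPartialIso.injOn_snd (h : IsPartialIso M N p) : Set.InjOn Prod.snd (p : Set (D × E)) :=
  fun q hq r hr e => Prod.ext ((h.1 q hq r hr).2 e) e

theorem IsPartialIso.swap (h : IsPartialIso M N p) : IsPartialIso N M (p.image Prod.swap) := by
  refine ⟨?_, fun Z hZ hm => ?_⟩
  · simp only [Finset.mem_image]
    rintro _ ⟨q, hq, rfl⟩ _ ⟨r, hr, rfl⟩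
    exact (h.1 q hq r hr).symm
  · intro q hq
    have hsub : Z.image Prod.swap ⊆ p := by
      intro r hr
      obtain ⟨s, hs, rfl⟩ := Finset.mem_image.1 hr
      obtain ⟨t, ht, rfl⟩ := Finset.mem_image.1 (hZ hs)
      simpa using ht
    have := h.2 _ hsub (by rwa [Finset.card_image_of_injective _ Prod.swap_injective]) q.swap
      (Finset.mem_image_of_mem _ hq)
    rw [Finset.image_image, Finset.image_image] at this
    exact this.symm

theorem IsPartialIso.sel_image (h : IsPartialIso M N p) {Z : Finset (D × E)} (hZ : Z ⊆ p)
    (hm : m < Z.card) :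
    N.sel (Z.image Prod.snd) =
      (Z.filter fun q => q.1 ∈ M.sel (Z.image Prod.fst)).image Prod.snd := by
  have hc : m < (Z.image Prod.snd).card := by
    rwa [Finset.card_image_of_injOn (h.injOn_snd.mono (by exact_mod_cast hZ))]
  ext e
  simp only [Finset.mem_image, Finset.mem_filter]
  constructor
  · intro he
    obtain ⟨q, hq, rfl⟩ := Finset.mem_image.1 (N.sel_subset _ hc he)
    exact ⟨q, ⟨hq, (h.2 Z hZ hm q hq).2 he⟩, rfl⟩
  · rintro ⟨q, ⟨hq, hq'⟩, rfl⟩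
    exact (h.2 Z hZ hm q hq).1 hq'

end PartialIso

/-- Partial isomorphisms into `F` extend to any further point, with arbitrarily large values. -/
def HasExtension (F : SelModel m ℕ) : Prop :=
  ∀ (D : Type) [DecidableEq D] (M : SelModel m D) (p : Finset (D × ℕ)), IsPartialIso M F p →
    ∀ d ∉ p.image Prod.fst, ∀ b : ℕ, ∃ c ≥ b, IsPartialIso M F (insert (d, c) p)

/-! ### A model with the extension property -/

/-- The finite relation that prescribes the selections from the sets with largest element `i`. -/
def task (i : ℕ) : Finset (Finset ℕ × Finset ℕ) :=
  Denumerable.ofNat _ i.unpair.1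

/-- The second coordinate of the pairing function is padding: it lets every relation recur beyond
any bound. -/
theorem exists_task_eq (R : Finset (Finset ℕ × Finset ℕ)) (b : ℕ) : ∃ i ≥ b, task i = R := by
  obtain ⟨k, hk⟩ := (Denumerable.eqv (Finset (Finset ℕ × Finset ℕ))).symm.surjective R
  refine ⟨Nat.pair k b, Nat.right_le_pair _ _, ?_⟩
  rw [task, Nat.unpair_pair]
  exact hk

/-- The set `V` is a selection from `Z` that the task of the largest element of `Z` allows. -/
def Allowed (m : ℕ) (Z V : Finset ℕ) : Prop :=
  V ⊆ Z ∧ V.card = m ∧ (Z.erase (Z.sup id), V.erase (Z.sup id)) ∈ task (Z.sup id)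

open Classical in
/-- A model of `T_m` in which the selections from a set are prescribed by its largest element. -/
noncomputable def taskModel (m : ℕ) : SelModel m ℕ where
  sel Z :=
    if h : ∃ V, Allowed m Z V then h.choose
    else if h : m < Z.card then (Finset.exists_subset_card_eq h.le).choose else ∅
  sel_subset Z hZ := by
    split_ifs with h
    · exact h.choose_spec.1
    · exact (Finset.exists_subset_card_eq hZ.le).choose_spec.1
  card_sel Z hZ := by
    split_ifs with h
    · exact h.choose_spec.2.1
    · exact (Finset.exists_subset_card_eq hZ.le).choose_spec.2

/-- A task determines the selection only up to membership of the largest element of `Z`. Since the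
selection has `m` elements, its cardinality settles that membership, so `V` is the only allowed
choice. -/
theorem taskModel_sel_eq {Z V : Finset ℕ} (hV : Allowed m Z V)
    (huniq : ∀ W W', (Z.erase (Z.sup id), W) ∈ task (Z.sup id) →
      (Z.erase (Z.sup id), W') ∈ task (Z.sup id) → W = W') : (taskModel m).sel Z = V := by
  have h : ∃ V, Allowed m Z V := ⟨V, hV⟩
  have hsel : (taskModel m).sel Z = h.choose := dif_pos h
  rw [hsel]
  obtain ⟨-, h2, h3⟩ := h.choose_spec
  have he := huniq _ _ h3 hV.2.2
  set U := h.choose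
  set i := Z.sup id
  have hc : U.card = V.card := h2.trans hV.2.1.symm
  by_cases hU : i ∈ U <;> by_cases hV' : i ∈ V
  · rw [← Finset.insert_erase hU, he, Finset.insert_erase hV']
  · have h4 := Finset.card_erase_add_one hU
    rw [he, Finset.erase_eq_of_notMem hV'] at h4
    omega
  · have h4 := Finset.card_erase_add_one hV'
    rw [← he, Finset.erase_eq_of_notMem hU] at h4
    omega
  · rwa [Finset.erase_eq_of_notMem hV', Finset.erase_eq_of_notMem hU] at he

theorem hasExtension_taskModel (m : ℕ) : (taskModel m).HasExtension := by
  intro D _ M p hp d hd b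
  -- The selection that `M` makes from the domain of `Z` with `d` added, carried over to `ω` without
  -- the new point.
  let val : Finset (D × ℕ) → Finset ℕ := fun Z =>
    (Z.filter fun q => q.1 ∈ M.sel (insert d (Z.image Prod.fst))).image Prod.snd
  -- The value of `d` exceeds all values of `p`, so it is the largest element of every image set
  -- containing it, and its task governs the selection there.
  obtain ⟨i, hi, hR⟩ := exists_task_eq (p.powerset.image fun Z => (Z.image Prod.snd, val Z))
    (max b ((p.image Prod.snd).sup id + 1))
  have hb : b ≤ i := (le_max_left _ _).trans hi
  have hlt : ∀ q ∈ p, q.2 < i := fun q hq => by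
    have h1 : q.2 ≤ (p.image Prod.snd).sup id :=
      Finset.le_sup (f := id) (Finset.mem_image_of_mem _ hq)
    have h2 := (le_max_right b _).trans hi
    omega
  have hdp : ∀ q ∈ p, q.1 ≠ d := fun q hq e => hd (e ▸ Finset.mem_image_of_mem _ hq)
  have hinj : ∀ q ∈ insert (d, i) p, ∀ r ∈ insert (d, i) p, q.1 = r.1 ↔ q.2 = r.2 := by
    intro q hq r hr
    rcases Finset.mem_insert.1 hq with rfl | hq <;> rcases Finset.mem_insert.1 hr with rfl | hr
    · simp
    · exact iff_of_false (hdp r hr).symm (hlt r hr).ne'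
    · exact iff_of_false (hdp q hq) (hlt q hq).ne
    · exact hp.1 q hq r hr
  refine ⟨i, hb, hinj, fun Y hY hm => ?_⟩
  by_cases hdY : (d, i) ∈ Y
  swap
  · exact hp.2 Y (fun q hq => (Finset.mem_insert.1 (hY hq)).resolve_left
      fun e => hdY (e ▸ hq)) hm
  have hYinj1 : Set.InjOn Prod.fst (Y : Set (D × ℕ)) := fun q hq r hr e =>
    Prod.ext e ((hinj q (hY hq) r (hY hr)).1 e)
  have hYinj2 : Set.InjOn Prod.snd (Y : Set (D × ℕ)) := fun q hq r hr e =>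
    Prod.ext ((hinj q (hY hq) r (hY hr)).2 e) e
  obtain ⟨Z, hZ, rfl⟩ : ∃ Z ⊆ p, Y = insert (d, i) Z :=
    ⟨Y.erase (d, i), fun q hq => (Finset.mem_insert.1 (hY (Finset.mem_of_mem_erase hq))).resolve_left
      (Finset.ne_of_mem_erase hq), (Finset.insert_erase hdY).symm⟩
  have hiZ : i ∉ Z.image Prod.snd := by
    simp only [Finset.mem_image, not_exists, not_and]
    exact fun q hq => (hlt q (hZ hq)).ne
  have hsup : ((insert (d, i) Z).image Prod.snd).sup id = i := by
    rw [Finset.image_insert, Finset.sup_insert]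
    refine sup_eq_left.2 (Finset.sup_le fun x hx => ?_)
    obtain ⟨q, hq, rfl⟩ := Finset.mem_image.1 hx
    exact (hlt q (hZ hq)).le
  set V := ((insert (d, i) Z).filter
    fun q => q.1 ∈ M.sel ((insert (d, i) Z).image Prod.fst)).image Prod.snd with hVdef
  have hVe : V.erase i = val Z := by
    ext x
    simp only [hVdef, val, Finset.mem_erase, Finset.mem_image, Finset.mem_filter,
      Finset.image_insert, Finset.mem_insert]
    constructor
    · rintro ⟨hx, q, ⟨rfl | hq, hq'⟩, rfl⟩
      · exact absurd rfl hx
      · exact ⟨q, ⟨hq, hq'⟩, rfl⟩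
    · rintro ⟨q, ⟨hq, hq'⟩, rfl⟩
      exact ⟨(hlt q (hZ hq)).ne, q, ⟨.inr hq, hq'⟩, rfl⟩
  have hme : ((insert (d, i) Z).image Prod.snd).erase i = Z.image Prod.snd := by
    rw [Finset.image_insert, Finset.erase_insert hiZ]
  have hall : Allowed m ((insert (d, i) Z).image Prod.snd) V := by
    refine ⟨Finset.image_subset_image (Finset.filter_subset _ _), ?_, ?_⟩
    · have hsub : (((insert (d, i) Z).filter fun q =>
          q.1 ∈ M.sel ((insert (d, i) Z).image Prod.fst) : Finset _) : Set (D × ℕ)) ⊆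
            (insert (d, i) Z : Finset _) := Finset.coe_subset.2 (Finset.filter_subset _ _)
      have hc1 : m < ((insert (d, i) Z).image Prod.fst).card := by
        rwa [Finset.card_image_of_injOn hYinj1]
      rw [Finset.card_image_of_injOn (hYinj2.mono hsub),
        ← Finset.card_image_of_injOn (hYinj1.mono hsub)]
      refine Eq.trans (congrArg Finset.card ?_) (M.card_sel _ hc1)
      ext x
      simp only [Finset.mem_image, Finset.mem_filter]
      constructor
      · rintro ⟨q, ⟨-, hq⟩, rfl⟩
        exact hq
      · intro hx
        obtain ⟨q, hq, rfl⟩ := Finset.mem_image.1 (M.sel_subset _ hc1 hx)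
        exact ⟨q, ⟨hq, hx⟩, rfl⟩
    · rw [hsup, hme, hVe, hR]
      exact Finset.mem_image_of_mem _ (Finset.mem_powerset.2 hZ)
  -- The task is single-valued: `p` is injective in the second coordinate, so a subset of `p` is
  -- recovered from its image.
  have hsel := taskModel_sel_eq hall (by
    rw [hsup, hme, hR]
    intro W W' hW hW'
    simp only [Finset.mem_image, Finset.mem_powerset, Prod.mk.injEq] at hW hW'
    obtain ⟨Z1, hZ1, e1, rfl⟩ := hW
    obtain ⟨Z2, hZ2, e2, rfl⟩ := hW'
    have : Z1 = Z2 := by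
      apply Finset.coe_injective
      refine (hp.injOn_snd.image_eq_image_iff (by exact_mod_cast hZ1) (by exact_mod_cast hZ2)).1 ?_
      exact_mod_cast congrArg (fun s : Finset ℕ => (s : Set ℕ)) (e1.trans e2.symm)
    rw [this])
  intro q hq
  rw [hsel, hVdef]
  simp only [Finset.mem_image, Finset.mem_filter]
  constructor
  · exact fun h => ⟨q, ⟨hq, h⟩, rfl⟩
  · rintro ⟨r, ⟨hr, hr'⟩, e⟩
    rwa [← hYinj2 hr hq e]

/-! ### The extension property implies genericity -/

theorem HasExtension.exists_isPartialIso {F : SelModel m ℕ} (hF : F.HasExtension) {D : Type}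
    [DecidableEq D] (M : SelModel m D) (b : ℕ) (A : Finset D) :
    ∃ p, IsPartialIso M F p ∧ p.image Prod.fst = A ∧ ∀ q ∈ p, b ≤ q.2 := by
  induction A using Finset.induction_on with
  | empty => exact ⟨∅, isPartialIso_empty, by simp, by simp⟩
  | insert d A hd ih =>
    obtain ⟨p, hp, rfl, hb⟩ := ih
    obtain ⟨c, hc, h⟩ := hF D M p hp d hd b
    refine ⟨_, h, by rw [Finset.image_insert], ?_⟩
    intro q hq
    rcases Finset.mem_insert.1 hq with rfl | hq
    exacts [hc, hb q hq]

/-- Finitely many finite sets are bounded, whereas a copy of `M` can be placed above any bound. As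
`M` is non-empty, such a copy is new. -/
theorem HasExtension.infinitely_many {F : SelModel m ℕ} (hF : F.HasExtension) (j : ℕ)
    (M : SelModel m (Fin j)) (hj : 0 < j) :
    {N : Finset ℕ | ∃ e : Fin j ↪ ℕ, M.IsEmbedding F e ∧ Finset.univ.map e = N}.Infinite := by
  intro hfin
  obtain ⟨p, hp, hdom, hb⟩ :=
    hF.exists_isPartialIso M ((hfin.toFinset.sup fun N => N.sup id) + 1) Finset.univ
  have hex : ∀ x : Fin j, ∃ y, (x, y) ∈ p := by
    intro x
    obtain ⟨q, hq, rfl⟩ := Finset.mem_image.1 (hdom ▸ Finset.mem_univ x)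
    exact ⟨q.2, hq⟩
  choose f hf using hex
  let e : Fin j ↪ ℕ := ⟨f, fun x y h => (hp.1 _ (hf x) _ (hf y)).2 h⟩
  have he : M.IsEmbedding F e := by
    intro X hX
    have hi : Function.Injective fun x => (x, f x) := fun x y h => congrArg Prod.fst h
    have h := hp.sel_image (Z := X.image fun x => (x, f x))
      (by intro q hq; obtain ⟨x, -, rfl⟩ := Finset.mem_image.1 hq; exact hf x)
      (by rwa [Finset.card_image_of_injective _ hi])
    rw [Finset.image_image, Finset.image_image] at h
    have h1 : X.image (Prod.fst ∘ fun x => (x, f x)) = X := by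
      ext; simp
    have h2 : X.image (Prod.snd ∘ fun x => (x, f x)) = X.map e := by
      rw [Finset.map_eq_image]; rfl
    rw [h1, h2] at h
    rw [h]
    ext y
    simp only [Finset.mem_image, Finset.mem_filter, Finset.mem_map]
    constructor
    · rintro ⟨_, ⟨⟨x, hx, rfl⟩, hx'⟩, rfl⟩
      exact ⟨x, hx', rfl⟩
    · rintro ⟨x, hx, rfl⟩
      exact ⟨(x, f x), ⟨⟨x, M.sel_subset X hX hx, rfl⟩, hx⟩, rfl⟩
  have hmem : Finset.univ.map e ∈ hfin.toFinset := by
    rw [Set.Finite.mem_toFinset]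
    exact ⟨e, he, rfl⟩
  have h1 := Finset.le_sup (f := fun N : Finset ℕ => N.sup id) hmem
  have h2 : f ⟨0, hj⟩ ≤ (Finset.univ.map e).sup id :=
    Finset.le_sup (f := id) (Finset.mem_map_of_mem e (Finset.mem_univ _))
  have h3 := hb _ (hf ⟨0, hj⟩)
  simp only at h1 h3
  omega

theorem HasExtension.exists_fst {F : SelModel m ℕ} (hF : F.HasExtension) {p : Finset (ℕ × ℕ)}
    (hp : IsPartialIso F F p) (x : ℕ) :
    ∃ p', IsPartialIso F F p' ∧ p ⊆ p' ∧ x ∈ p'.image Prod.fst := by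
  by_cases hx : x ∈ p.image Prod.fst
  · exact ⟨p, hp, subset_rfl, hx⟩
  · obtain ⟨c, -, h⟩ := hF ℕ F p hp x hx 0
    exact ⟨_, h, Finset.subset_insert _ _, by simp⟩

theorem HasExtension.exists_snd {F : SelModel m ℕ} (hF : F.HasExtension) {p : Finset (ℕ × ℕ)}
    (hp : IsPartialIso F F p) (x : ℕ) :
    ∃ p', IsPartialIso F F p' ∧ p ⊆ p' ∧ x ∈ p'.image Prod.snd := by
  obtain ⟨p', h1, h2, h3⟩ := hF.exists_fst hp.swap x
  refine ⟨_, h1.swap, fun q hq => ?_, ?_⟩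
  · exact Finset.mem_image.2 ⟨q.swap, h2 (Finset.mem_image_of_mem _ hq), q.swap_swap⟩
  · rw [Finset.image_image]
    exact h3

/-- Back-and-forth: stage `n` puts `n` into both the domain and the range, and the union of the
chain is the graph of the automorphism. -/
theorem HasExtension.exists_aut {F : SelModel m ℕ} (hF : F.HasExtension) {p : Finset (ℕ × ℕ)}
    (hp : IsPartialIso F F p) : ∃ π ∈ F.aut, ∀ q ∈ p, π q.1 = q.2 := by
  have step : ∀ (n : ℕ) (r : {p // IsPartialIso F F p}), ∃ r' : {p // IsPartialIso F F p},
      r.1 ⊆ r'.1 ∧ n ∈ r'.1.image Prod.fst ∧ n ∈ r'.1.image Prod.snd := by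
    rintro n ⟨p, hp⟩
    obtain ⟨p1, h1, h2, h3⟩ := hF.exists_fst hp n
    obtain ⟨p2, h4, h5, h6⟩ := hF.exists_snd h1 n
    exact ⟨⟨p2, h4⟩, h2.trans h5, Finset.image_subset_image h5 h3, h6⟩
  choose next hn1 hn2 hn3 using step
  obtain ⟨s, hs0, hs⟩ : ∃ s : ℕ → {p // IsPartialIso F F p},
      s 0 = ⟨p, hp⟩ ∧ ∀ n, s (n + 1) = next n (s n) :=
    ⟨fun n => Nat.rec ⟨p, hp⟩ (fun n r => next n r) n, rfl, fun _ => rfl⟩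
  have hmono : Monotone fun n => (s n).1 := monotone_nat_of_le_succ fun n => by
    rw [hs]
    exact hn1 n (s n)
  have hmem : ∀ {a b : ℕ} {q r : ℕ × ℕ}, q ∈ (s a).1 → r ∈ (s b).1 → (q.1 = r.1 ↔ q.2 = r.2) := by
    intro a b q r hq hr
    exact (s (max a b)).2.1 q (hmono (le_max_left a b) hq) r (hmono (le_max_right a b) hr)
  have hex1 : ∀ x, ∃ y, (x, y) ∈ (s (x + 1)).1 := fun x => by
    obtain ⟨q, hq, e⟩ := Finset.mem_image.1 (hn2 x (s x))
    exact ⟨q.2, by subst e; rw [hs]; exact hq⟩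
  have hex2 : ∀ y, ∃ x, (x, y) ∈ (s (y + 1)).1 := fun y => by
    obtain ⟨q, hq, e⟩ := Finset.mem_image.1 (hn3 y (s y))
    exact ⟨q.1, by subst e; rw [hs]; exact hq⟩
  choose f hf using hex1
  choose g hg using hex2
  have hgf : ∀ x, g (f x) = x := fun x => by
    have h := hmem (hg (f x)) (hf x)
    exact h.2 rfl
  have hfg : ∀ y, f (g y) = y := fun y => by
    have h := hmem (hf (g y)) (hg y)
    exact h.1 rfl
  let π : Equiv.Perm ℕ := ⟨f, g, hgf, hfg⟩
  refine ⟨π, fun X hX => ?_, fun q hq => ?_⟩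
  swap
  · have h := hmem (b := 0) (hf q.1) (by rw [hs0]; exact hq)
    exact h.1 rfl
  have hi : Function.Injective fun x => (x, f x) := fun x y h => congrArg Prod.fst h
  -- All pairs `(x, f x)` with `x ∈ X` are present at stage `X.sup id + 1`, so that stage already
  -- compares the two selections.
  have h := (s (X.sup id + 1)).2.sel_image (Z := X.image fun x => (x, f x))
    (by
      intro q hq
      obtain ⟨x, hx, rfl⟩ := Finset.mem_image.1 hq
      exact hmono (Nat.succ_le_succ (Finset.le_sup (f := id) hx)) (hf x))
    (by rwa [Finset.card_image_of_injective _ hi])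
  rw [Finset.image_image, Finset.image_image] at h
  have h1 : X.image (Prod.fst ∘ fun x => (x, f x)) = X := by
    ext; simp
  have h2 : X.image (Prod.snd ∘ fun x => (x, f x)) = X.map π.toEmbedding := by
    rw [Finset.map_eq_image]; rfl
  rw [h1, h2] at h
  rw [h]
  ext y
  simp only [Finset.mem_image, Finset.mem_filter, Finset.mem_map]
  constructor
  · rintro ⟨_, ⟨⟨x, hx, rfl⟩, hx'⟩, rfl⟩
    exact ⟨x, hx', rfl⟩
  · rintro ⟨x, hx, rfl⟩
    exact ⟨(x, f x), ⟨⟨x, F.sel_subset X hX hx, rfl⟩, hx⟩, rfl⟩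

theorem HasExtension.isGeneric {F : SelModel m ℕ} (hF : F.HasExtension) : F.IsGeneric where
  infinitely_many := hF.infinitely_many
  homogeneous X e he hsel := by
    have hi : Function.Injective fun x => (x, e x) := fun x y h => congrArg Prod.fst h
    have hp : IsPartialIso F F (X.image fun x => (x, e x)) := by
      refine ⟨?_, ?_⟩
      · simp only [Finset.mem_image]
        rintro _ ⟨x, hx, rfl⟩ _ ⟨y, hy, rfl⟩
        exact (he.eq_iff hx hy).symm
      · intro Z hZ hm
        obtain ⟨Y, hY, rfl⟩ := Finset.subset_image_iff.1 hZ
        rw [Finset.card_image_of_injective _ hi] at hm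
        intro q hq
        obtain ⟨x, hx, rfl⟩ := Finset.mem_image.1 hq
        rw [Finset.image_image, Finset.image_image]
        have h1 : Y.image (Prod.fst ∘ fun x => (x, e x)) = Y := by
          ext; simp
        have h2 : Y.image (Prod.snd ∘ fun x => (x, e x)) = Y.image e := rfl
        rw [h1, h2, hsel Y (by exact_mod_cast hY) hm]
        constructor
        · exact fun h => Finset.mem_image_of_mem e h
        · intro h
          obtain ⟨y, hy, hyx⟩ := Finset.mem_image.1 h
          rwa [← he (hY (F.sel_subset Y hm hy)) (hY hx) hyx]
    obtain ⟨π, hπ, h⟩ := hF.exists_aut hp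
    exact ⟨π, hπ, fun x hx => h _ (Finset.mem_image_of_mem (fun x => (x, e x)) hx)⟩

theorem exists_isGeneric (m : ℕ) : ∃ F : SelModel m ℕ, F.IsGeneric :=
  ⟨taskModel m, (hasExtension_taskModel m).isGeneric⟩

end SelModel

/-! ### Equivariant choice and invariant subsets for group actions -/

open scoped Pointwise in
/-- A relation that is invariant under a group action is uniformized by an equivariant function if
every `x` is related to some `y` that is fixed by the stabilizer of `x`. -/
theorem exists_equivariant_uniformization {G α β : Type*} [Group G] [MulAction G α] [MulAction G β]
    (P : α → β → Prop) (hP : ∀ (g : G) x y, P x y → P (g • x) (g • y))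
    (h : ∀ x, ∃ y, P x y ∧ ∀ g : G, g • x = x → g • y = y) :
    ∃ f : α → β, (∀ x, P x (f x)) ∧ ∀ (g : G) x, f (g • x) = g • f x := by
  choose y hy hfix using h
  let rep : α → α := fun x => (Quotient.mk (MulAction.orbitRel G α) x).out
  have hrep : ∀ x, ∃ g : G, g • rep x = x := fun x => by
    have h := Quotient.mk_out (s := MulAction.orbitRel G α) x
    obtain ⟨g, hg⟩ := (MulAction.orbitRel G α).symm h
    exact ⟨g, hg⟩
  have hrep' : ∀ (g : G) x, rep (g • x) = rep x := fun g x =>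
    congrArg Quotient.out (Quotient.sound (s := MulAction.orbitRel G α) ⟨g, rfl⟩)
  choose t ht using hrep
  -- Choose on one representative per orbit and translate. The choice of `t x` does not matter,
  -- since the stabilizer of `rep x` fixes `y (rep x)`.
  refine ⟨fun x => t x • y (rep x), fun x => ?_, fun g x => ?_⟩
  · have := hP (t x) _ _ (hy (rep x))
    rwa [ht] at this
  · have h1 : ((t (g • x))⁻¹ * (g * t x)) • rep x = rep x := by
      rw [mul_smul, mul_smul, ht, inv_smul_eq_iff, ← hrep' g x, ht]
    have h2 := hfix _ _ h1
    rw [mul_smul, mul_smul, inv_smul_eq_iff] at h2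
    simp only [hrep']
    exact h2.symm

open scoped Pointwise in
/-- If a finite group `H` acts freely on the finite set `T`, then `T` has invariant subsets whose
size is any given multiple of the order of `H`. -/
theorem exists_invariant_subset {H E : Type*} [Group H] [Finite H] [DecidableEq E] [MulAction H E]
    (T : Finset E) (hT : ∀ h : H, h • T = T) (hfree : ∀ x ∈ T, ∀ h : H, h • x = x → h = 1) (r : ℕ)
    (hr : r * Nat.card H ≤ T.card) :
    ∃ W ⊆ T, (∀ h : H, h • W = W) ∧ W.card = r * Nat.card H := by
  induction r with
  | zero => exact ⟨∅, by simp, by simp, by simp⟩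
  | succ r ih =>
    rw [Nat.succ_mul] at hr
    obtain ⟨W, hWT, hW, hc⟩ := ih (by omega)
    have hpos : 0 < Nat.card H := Nat.card_pos
    obtain ⟨x, hxT, hxW⟩ : ∃ x ∈ T, x ∉ W := Finset.exists_mem_notMem_of_card_lt_card (by omega)
    have : Fintype H := Fintype.ofFinite H
    have hmem : ∀ (A : Finset E), (∀ h : H, h • A = A) → ∀ (h : H) (x : E), h • x ∈ A ↔ x ∈ A := by
      intro A hA h x
      conv_lhs => rw [← hA h]
      exact Finset.smul_mem_smul_finset_iff h
    have hinj : Function.Injective fun h : H => h • x := fun h h' e => by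
      have : (h'⁻¹ * h) • x = x := by rw [mul_smul, inv_smul_eq_iff]; exact e
      exact (inv_mul_eq_one.1 (hfree x hxT _ this)).symm
    -- Adjoin the whole orbit of a point outside `W`; it has as many elements as `H` by freeness and
    -- misses `W` by invariance.
    refine ⟨W ∪ Finset.univ.image fun h : H => h • x, ?_, ?_, ?_⟩
    · refine Finset.union_subset hWT fun y hy => ?_
      obtain ⟨h, -, rfl⟩ := Finset.mem_image.1 hy
      exact (hmem T hT h x).2 hxT
    · intro h
      rw [Finset.smul_finset_union, hW]
      congr 1
      ext y
      simp only [Finset.mem_smul_finset, Finset.mem_image, Finset.mem_univ, true_and]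
      constructor
      · rintro ⟨_, ⟨g, rfl⟩, rfl⟩
        exact ⟨h * g, mul_smul _ _ _⟩
      · rintro ⟨g, rfl⟩
        exact ⟨_, ⟨h⁻¹ * g, rfl⟩, by rw [← mul_smul, mul_inv_cancel_left]⟩
    · rw [Finset.card_union_of_disjoint, hc, Finset.card_image_of_injective _ hinj,
        Finset.card_univ, Nat.card_eq_fintype_card, Nat.succ_mul]
      rw [Finset.disjoint_right]
      intro y hy hyW
      obtain ⟨h, -, rfl⟩ := Finset.mem_image.1 hy
      exact hxW ((hmem W hW h x).1 hyW)

/-! ### Embeddings of finite submodels and construction of auxiliary models -/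

namespace SelModel

variable {m : ℕ}

/-- The function `g` is an embedding of the finite submodel `A` of `M` into `F`. -/
def IsEmbeddingOn {D E : Type*} [DecidableEq E] (M : SelModel m D) (F : SelModel m E)
    (A : Finset D) (g : D → E) : Prop :=
  Set.InjOn g A ∧ ∀ Z ⊆ A, m < Z.card → F.sel (Z.image g) = (M.sel Z).image g

section IsEmbeddingOn

variable {D E E' : Type*} [DecidableEq E] [DecidableEq E'] {M : SelModel m D}
  {N : SelModel m E} {F : SelModel m E'} {A : Finset D} {g : D → E}

theorem IsEmbeddingOn.mono (h : IsEmbeddingOn M N A g) {A' : Finset D} (hA : A' ⊆ A) :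
    IsEmbeddingOn M N A' g :=
  ⟨h.1.mono (by exact_mod_cast hA), fun Z hZ => h.2 Z (hZ.trans hA)⟩

theorem IsEmbeddingOn.comp (hg : IsEmbeddingOn M N A g) {B : Finset E} {f : E → E'}
    (hf : IsEmbeddingOn N F B f) (hAB : A.image g ⊆ B) : IsEmbeddingOn M F A (f ∘ g) := by
  have hmaps : Set.MapsTo g A B := fun x hx => hAB (Finset.mem_image_of_mem g hx)
  refine ⟨hf.1.comp hg.1 hmaps, fun Z hZ hm => ?_⟩
  rw [← Finset.image_image, ← Finset.image_image, ← hg.2 Z hZ hm]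
  refine hf.2 _ ((Finset.image_subset_image hZ).trans hAB) ?_
  rwa [Finset.card_image_of_injOn (hg.1.mono (by exact_mod_cast hZ))]

theorem IsEmbeddingOn.inverse [DecidableEq D] (hg : IsEmbeddingOn M N A g) {f : E → D}
    (h : ∀ x ∈ A, f (g x) = x) :
    IsEmbeddingOn N M (A.image g) f := by
  refine ⟨?_, fun Y hY hm => ?_⟩
  · intro y hy z hz e
    obtain ⟨x, hx, rfl⟩ := Finset.mem_image.1 (Finset.mem_coe.1 hy)
    obtain ⟨x', hx', rfl⟩ := Finset.mem_image.1 (Finset.mem_coe.1 hz)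
    rw [h x hx, h x' hx'] at e
    rw [e]
  · obtain ⟨Z, hZ, rfl⟩ := Finset.subset_image_iff.1 hY
    have hZ' : Z ⊆ A := by exact_mod_cast hZ
    rw [Finset.card_image_of_injOn (hg.1.mono hZ)] at hm
    have hid : ∀ X ⊆ A, (X.image g).image f = X := by
      intro X hX
      rw [Finset.image_image]
      exact (Finset.image_congr (g := id) fun x hx => h x (hX hx)).trans Finset.image_id
    rw [hid Z hZ', hg.2 Z hZ' hm, hid _ ((M.sel_subset Z hm).trans hZ')]

theorem isEmbeddingOn_of_mem_aut {π : Equiv.Perm E} (hπ : π ∈ N.aut) (A : Finset E) :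
    IsEmbeddingOn N N A π := by
  refine ⟨π.injective.injOn, fun Z _ hm => ?_⟩
  have := hπ Z hm
  rw [Finset.map_eq_image, Finset.map_eq_image] at this
  exact this

/-- The selections from `Z` that make `q` an embedding, for `q` injective on `Z`. -/
theorem exists_pullback (N : SelModel m E) {q : D → E} {Z : Finset D} (hq : Set.InjOn q Z)
    (hm : m < Z.card) :
    (Z.filter fun x => q x ∈ N.sel (Z.image q)) ⊆ Z ∧
      (Z.filter fun x => q x ∈ N.sel (Z.image q)).card = m ∧
      (Z.filter fun x => q x ∈ N.sel (Z.image q)).image q = N.sel (Z.image q) := by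
  have hc : m < (Z.image q).card := by rwa [Finset.card_image_of_injOn hq]
  have h1 : (Z.filter fun x => q x ∈ N.sel (Z.image q)).image q = N.sel (Z.image q) := by
    ext y
    simp only [Finset.mem_image, Finset.mem_filter]
    constructor
    · rintro ⟨x, ⟨-, hx⟩, rfl⟩
      exact hx
    · intro hy
      obtain ⟨x, hx, rfl⟩ := Finset.mem_image.1 (N.sel_subset _ hc hy)
      exact ⟨x, ⟨hx, hy⟩, rfl⟩
  refine ⟨Finset.filter_subset _ _, ?_, h1⟩
  have h2 := N.card_sel _ hc
  rw [← h1, Finset.card_image_of_injOn] at h2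
  · exact h2
  · exact hq.mono (Finset.coe_subset.2 (Finset.filter_subset _ _))

/-- Partial maps to `N` that agree up to automorphisms of `N` become embeddings for a suitable
structure of a model of `T_m`. -/
theorem exists_isEmbeddingOn_of_agree {ι : Type*} [LinearOrder ι] (N : SelModel m E)
    (Z : ι → Finset D) (q : ι → D → E) (hq : ∀ i, Set.InjOn (q i) (Z i))
    (hagree : ∀ i j, i < j → ∃ ρ ∈ N.aut, ∀ x ∈ Z i, x ∈ Z j → q j x = ρ (q i x)) :
    ∃ M : SelModel m D, ∀ i, IsEmbeddingOn M N (Z i) (q i) := by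
  have hagree' : ∀ i j, ∃ ρ ∈ N.aut, ∀ x ∈ Z i, x ∈ Z j → q j x = ρ (q i x) := by
    intro i j
    rcases lt_trichotomy i j with h | rfl | h
    · exact hagree i j h
    · exact ⟨1, N.aut.one_mem, fun _ _ _ => rfl⟩
    · obtain ⟨ρ, hρ, h⟩ := hagree j i h
      exact ⟨ρ⁻¹, N.aut.inv_mem hρ, fun x hi hj => by rw [h x hj hi]; exact (ρ.symm_apply_apply _).symm⟩
  have hex : ∀ Y : Finset D, ∃ W : Finset D, m < Y.card → W ⊆ Y ∧ W.card = m ∧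
      ∀ i, Y ⊆ Z i → N.sel (Y.image (q i)) = W.image (q i) := by
    intro Y
    by_cases hm : m < Y.card
    swap
    · exact ⟨∅, fun h => absurd h hm⟩
    by_cases hi : ∃ i, Y ⊆ Z i
    · obtain ⟨i, hi⟩ := hi
      have hqi := (hq i).mono (Finset.coe_subset.2 hi)
      obtain ⟨h1, h2, h3⟩ := exists_pullback N hqi hm
      -- The selection is pulled back along `q i`. Any other `q j` defined on `Y` differs from it by
      -- an automorphism of `N`, hence pulls back the same set.
      refine ⟨_, fun _ => ⟨h1, h2, fun j hj => ?_⟩⟩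
      obtain ⟨ρ, hρ, h⟩ := hagree' i j
      have hc : ∀ X ⊆ Y, X.image (q j) = (X.image (q i)).image ρ := by
        intro X hX
        rw [Finset.image_image]
        exact Finset.image_congr fun x hx => h x (hi (hX hx)) (hj (hX hx))
      rw [hc _ subset_rfl, hc _ h1, h3]
      exact (isEmbeddingOn_of_mem_aut hρ (Y.image (q i))).2 _ subset_rfl
        (by rwa [Finset.card_image_of_injOn hqi])
    · obtain ⟨W, h1, h2⟩ := Finset.exists_subset_card_eq hm.le
      exact ⟨W, fun _ => ⟨h1, h2, fun i h => absurd ⟨i, h⟩ hi⟩⟩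
  choose sel hsel using hex
  exact ⟨⟨sel, fun Y hY => (hsel Y hY).1, fun Y hY => (hsel Y hY).2.1⟩,
    fun i => ⟨hq i, fun Y hY hm => (hsel Y hm).2.2 i hY⟩⟩

open scoped Pointwise in
/-- A finite group whose order divides `m` and that acts on `D`, moving every point freely or not at
all, acts by automorphisms for a suitable structure of a model of `T_m` on `D`, which can be chosen
such that a given invariant map to a model is an embedding wherever it is injective. -/
theorem exists_invariant_selModel [DecidableEq D] {G : Type*} [Group G] [Finite G] [MulAction G D]
    (hG : Nat.card G ∣ m) (hfree : ∀ x : D, (∀ g : G, g • x = x) ∨ ∀ g : G, g • x = x → g = 1)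
    (N : SelModel m E) (q : D → E) (hq : ∀ (g : G) x, q (g • x) = q x) :
    ∃ M : SelModel m D, (∀ (g : G) Z, M.sel (g • Z) = g • M.sel Z) ∧
      ∀ Z : Finset D, Set.InjOn q Z → IsEmbeddingOn M N Z q := by
  have hqZ : ∀ (g : G) (Z : Finset D), (g • Z).image q = Z.image q := by
    intro g Z
    rw [← Finset.image_smul, Finset.image_image]
    exact Finset.image_congr fun x _ => hq g x
  obtain ⟨sel, hsel, hequi⟩ := exists_equivariant_uniformization (G := G)
    (fun Z W : Finset D => m < Z.card → W ⊆ Z ∧ W.card = m ∧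
      (Set.InjOn q Z → N.sel (Z.image q) = W.image q)) (by
    intro g Z W h hm
    rw [Finset.card_smul_finset] at hm
    obtain ⟨h1, h2, h3⟩ := h hm
    refine ⟨Finset.smul_finset_subset_smul_finset h1, by rwa [Finset.card_smul_finset], ?_⟩
    intro hi
    rw [hqZ, hqZ]
    refine h3 fun x hx y hy e => ?_
    have := @hi (g • x)
      (Finset.mem_coe.2 (Finset.smul_mem_smul_finset (Finset.mem_coe.1 hx))) (g • y)
      (Finset.mem_coe.2 (Finset.smul_mem_smul_finset (Finset.mem_coe.1 hy)))
      (by rw [hq, hq, e])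
    exact smul_left_cancel g this) (by
    intro Z
    by_cases hm : m < Z.card
    swap
    · exact ⟨∅, fun h => absurd h hm, by simp⟩
    -- If `q` is injective on `Z`, then the stabilizer of `Z` fixes `Z` pointwise, because `q` is
    -- constant on orbits. The selection forced by `q` is therefore invariant.
    by_cases hi : Set.InjOn q Z
    · obtain ⟨h1, h2, h3⟩ := exists_pullback N hi hm
      refine ⟨_, fun _ => ⟨h1, h2, fun _ => h3.symm⟩, fun g hg => ?_⟩
      have hfix : ∀ x ∈ Z, g • x = x := fun x hx =>
        hi (Finset.mem_coe.2 (hg ▸ Finset.smul_mem_smul_finset hx)) hx (hq g x)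
      rw [← Finset.image_smul]
      rw [Finset.image_congr (g := id) fun x hx => hfix x (h1 hx)]
      exact Finset.image_id
    · classical
      let H := MulAction.stabilizer G Z
      have hH : Nat.card H ∣ m := (Subgroup.card_subgroup_dvd_card H).trans hG
      let T := Z.filter fun x => ¬ ∀ g : G, g • x = x
      let U := Z.filter fun x => ∀ g : G, g • x = x
      have hTU : U.card + T.card = Z.card := Finset.card_filter_add_card_filter_not _
      have hT : ∀ h : H, h • T = T := by
        rintro ⟨h, hh⟩
        have hZ : h • Z = Z := hh
        refine Finset.eq_of_subset_of_card_le ?_ (Finset.card_smul_finset _ _).ge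
        intro y hy
        obtain ⟨x, hx, rfl⟩ := Finset.mem_smul_finset.1 hy
        obtain ⟨hx1, hx2⟩ := Finset.mem_filter.1 hx
        refine Finset.mem_filter.2 ⟨?_, fun hf => hx2 fun g => ?_⟩
        · rw [← hZ]
          exact Finset.smul_mem_smul_finset hx1
        · have h1 := hf h⁻¹
          have h2 : h⁻¹ • h • x = h • x := h1
          rw [inv_smul_smul] at h2
          have h3 : g • h • x = h • x := hf g
          rwa [← h2] at h3
      have hTfree : ∀ x ∈ T, ∀ h : H, h • x = x → h = 1 := by
        intro x hx h e
        exact Subtype.ext (((hfree x).resolve_left (Finset.mem_filter.1 hx).2) h.1 e)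
      have hsub : T ⊆ Z := Finset.filter_subset _ _
      -- If there are enough moved points, take free orbits of `H`, which is possible as the order
      -- of `H` divides `m`. Otherwise take all of `T` and fill up with fixed points, of which `m <
      -- Z.card` provides enough.
      by_cases hc : m ≤ T.card
      · obtain ⟨r, hr⟩ := hH
        rw [mul_comm] at hr
        obtain ⟨W, h1, h2, h3⟩ := exists_invariant_subset T hT hTfree r (hr ▸ hc)
        exact ⟨W, fun _ => ⟨h1.trans hsub, h3.trans hr.symm, fun h => absurd h hi⟩,
          fun g hg => h2 ⟨g, hg⟩⟩
      · obtain ⟨W, h1, h2⟩ : ∃ W ⊆ U, W.card = m - T.card :=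
          Finset.exists_subset_card_eq (by omega)
        refine ⟨W ∪ T, fun _ => ⟨?_, ?_, fun h => absurd h hi⟩, fun g hg => ?_⟩
        · exact Finset.union_subset (h1.trans (Finset.filter_subset _ _)) hsub
        · rw [Finset.card_union_of_disjoint, h2]
          · omega
          · exact (Finset.disjoint_filter_filter_not Z Z _).mono_left h1
        · rw [Finset.smul_finset_union]
          congr 1
          · rw [← Finset.image_smul]
            rw [Finset.image_congr (g := id) fun x hx => (Finset.mem_filter.1 (h1 hx)).2 g]
            exact Finset.image_id
          · exact hT ⟨g, hg⟩)
  exact ⟨⟨sel, fun Y hY => (hsel Y hY).1, fun Y hY => (hsel Y hY).2.1⟩, hequi,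
    fun Z hZ => ⟨hZ, fun Y hY hm => (hsel Y hm).2.2 (hZ.mono (by exact_mod_cast hY))⟩⟩

end IsEmbeddingOn

/-! ### Consequences of genericity -/

/-- Homogeneity applied to `h ∘ g⁻¹` on `g(A)`. In this form the common source may be any auxiliary
model. -/
theorem IsGeneric.exists_aut {F : SelModel m ℕ} (hF : F.IsGeneric) {D : Type*} [DecidableEq D]
    {M : SelModel m D} {A : Finset D} {g h : D → ℕ} (hg : IsEmbeddingOn M F A g)
    (hh : IsEmbeddingOn M F A h) : ∃ π ∈ F.aut, ∀ x ∈ A, π (g x) = h x := by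
  rcases A.eq_empty_or_nonempty with rfl | ⟨x₀, -⟩
  · exact ⟨1, F.aut.one_mem, by simp⟩
  have : Nonempty D := ⟨x₀⟩
  have hinv : ∀ x ∈ A, Function.invFunOn g A (g x) = x := fun x hx =>
    hg.1.leftInvOn_invFunOn hx
  have hk := hg.inverse hinv
  have hc := hk.comp hh (by
    rw [Finset.image_image]
    intro y hy
    obtain ⟨x, hx, rfl⟩ := Finset.mem_image.1 hy
    rw [Function.comp_apply, hinv x hx]
    exact hx)
  obtain ⟨π, hπ, h⟩ := hF.homogeneous _ _ hc.1 hc.2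
  refine ⟨π, hπ, fun x hx => ?_⟩
  rw [h _ (Finset.mem_image_of_mem g hx), Function.comp_apply, hinv x hx]

theorem IsGeneric.exists_isEmbeddingOn {F : SelModel m ℕ} (hF : F.IsGeneric) {D : Type*}
    [DecidableEq D] (M : SelModel m D) (A : Finset D) : ∃ g, IsEmbeddingOn M F A g := by
  rcases A.eq_empty_or_nonempty with rfl | ⟨x₀, hx₀⟩
  · refine ⟨fun _ => 0, by simp, fun Z hZ hm => ?_⟩
    rw [Finset.subset_empty.1 hZ] at hm
    simp at hm
  have hpos : 0 < A.card := Finset.card_pos.2 ⟨x₀, hx₀⟩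
  let ι : Fin A.card → D := fun i => A.equivFin.symm i
  have hι : Function.Injective ι := Subtype.val_injective.comp A.equivFin.symm.injective
  have hιA : ∀ x ∈ A, ∃ i, ι i = x := fun x hx => ⟨A.equivFin ⟨x, hx⟩, by simp [ι]⟩
  -- Genericity speaks of models on `Fin j`, so `M` is pulled back along an enumeration of `A`; with
  -- a single map the agreement condition is empty.
  obtain ⟨M', hM'⟩ := exists_isEmbeddingOn_of_agree (ι := Unit) M
    (fun _ => (Finset.univ : Finset (Fin A.card))) (fun _ => ι) (fun _ => hι.injOn)
    (fun i j h => absurd h (lt_irrefl _))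
  obtain ⟨-, e, he, -⟩ := (hF.infinitely_many _ M' hpos).nonempty
  have he' : IsEmbeddingOn M' F Finset.univ e := by
    refine ⟨e.injective.injOn, fun Z _ hm => ?_⟩
    have := he Z hm
    rwa [Finset.map_eq_image, Finset.map_eq_image] at this
  have : Nonempty (Fin A.card) := ⟨⟨0, hpos⟩⟩
  have hA : A = Finset.univ.image ι := by
    ext x
    simp only [Finset.mem_image, Finset.mem_univ, true_and]
    refine ⟨hιA x, ?_⟩
    rintro ⟨i, rfl⟩
    exact (A.equivFin.symm i).2
  have hinv := (hM' ()).inverse (f := Function.invFun ι) fun x _ =>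
    Function.leftInverse_invFun hι x
  rw [← hA] at hinv
  exact ⟨_, hinv.comp he' (Finset.subset_univ _)⟩

/-- Embed `A` anywhere, then move the copy of `S` to the prescribed place by an automorphism. -/
theorem IsGeneric.exists_extension {F : SelModel m ℕ} (hF : F.IsGeneric) {D : Type*}
    [DecidableEq D] {M : SelModel m D} {S : Finset D} {g : D → ℕ} (hg : IsEmbeddingOn M F S g)
    {A : Finset D} (hSA : S ⊆ A) : ∃ h, IsEmbeddingOn M F A h ∧ ∀ x ∈ S, h x = g x := by
  obtain ⟨h, hh⟩ := hF.exists_isEmbeddingOn M A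
  obtain ⟨π, hπ, he⟩ := hF.exists_aut (hh.mono hSA) hg
  exact ⟨_, hh.comp (isEmbeddingOn_of_mem_aut hπ (A.image h)) subset_rfl, he⟩

end SelModel

/-! ### Cycles and amalgamation in generic models -/

/-- The cyclic group `ℤ/m` acting on the second summand of `ℕ ⊕ ι × ℤ/m` by translations. -/
@[reducible]
def cyclicAction (m : ℕ) (ι : Type*) :
    MulAction (Multiplicative (ZMod m)) (ℕ ⊕ ι × ZMod m) where
  smul g x := x.map id fun p => (p.1, p.2 + g.toAdd)
  one_smul x := by
    rcases x with x | ⟨i, j⟩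
    · rfl
    · exact congrArg Sum.inr (Prod.ext rfl (add_zero j))
  mul_smul g h x := by
    rcases x with x | ⟨i, j⟩
    · rfl
    · refine congrArg Sum.inr (Prod.ext rfl ?_)
      change j + (g.toAdd + h.toAdd) = j + h.toAdd + g.toAdd
      ring

namespace SelModel

variable {m : ℕ}

open scoped Pointwise in
-- The points `c i` realize a translation-invariant model over `S`. Translation is an automorphism
-- of this finite model and so extends to `π`; since each new point has the same type over `S` as
-- `a`, homogeneity also gives the `ρ`.
theorem IsGeneric.exists_cycles {F : SelModel m ℕ} (hF : F.IsGeneric) (hm : 0 < m) (S : Finset ℕ)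
    {a : ℕ} (ha : a ∉ S) (k : ℕ) :
    ∃ c : Fin k × ZMod m → ℕ, Function.Injective c ∧
      (∀ i, ∃ ρ ∈ AtomSet.fixing F.aut (S : Set ℕ), ρ a = c i) ∧
      ∃ π ∈ AtomSet.fixing F.aut (S : Set ℕ), ∀ i j, π (c (i, j)) = c (i, j + 1) := by
  have : NeZero m := ⟨hm.ne'⟩
  let _ := cyclicAction m (Fin k)
  -- All new points are collapsed to `a`. On `S` with one new point `q` is injective, because `a ∉
  -- S`, so there the model must copy `S ∪ {a}`.
  let q : ℕ ⊕ Fin k × ZMod m → ℕ := Sum.elim id fun _ => a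
  obtain ⟨M, hM, hq⟩ := exists_invariant_selModel (G := Multiplicative (ZMod m)) (m := m)
    (Nat.card_zmod m).dvd (by
      rintro (x | ⟨i, j⟩)
      · exact .inl fun g => rfl
      · refine .inr fun g hg => ?_
        have h : j + g.toAdd = j := congrArg Prod.snd (Sum.inr_injective hg)
        exact add_eq_left.1 h) F q (by
      rintro g (x | ⟨i, j⟩) <;> rfl)
  obtain ⟨h, hh, hS⟩ := hF.exists_extension (S := S.disjSum ∅) (A := S.disjSum Finset.univ)
    (hq _ (by
      rintro (x | x) hx (y | y) hy e
      · exact congrArg Sum.inl e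
      all_goals simp at hx hy)) (Finset.disjSum_mono subset_rfl (Finset.subset_univ _))
  have hS' : ∀ s ∈ S, h (Sum.inl s) = s := fun s hs =>
    hS _ (Finset.inl_mem_disjSum.2 hs)
  refine ⟨fun i => h (Sum.inr i), fun i j e => ?_, fun i => ?_, ?_⟩
  · exact Sum.inr_injective (hh.1 (by simp) (by simp) e)
  · obtain ⟨ρ, hρ, hρ'⟩ := hF.exists_aut (A := S.disjSum {i}) (hq _ (by
      rintro (x | x) hx (y | y) hy e
      · exact congrArg Sum.inl e
      · simp at hx
        exact absurd (show x = a from e) (ne_of_mem_of_not_mem hx ha)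
      · simp at hy
        exact absurd (show a = y from e).symm (ne_of_mem_of_not_mem hy ha)
      · simp at hx hy
        rw [hx, hy])) (hh.mono (Finset.disjSum_mono subset_rfl (Finset.subset_univ _)))
    refine ⟨ρ, ⟨hρ, fun s hs => ?_⟩, hρ' (Sum.inr i) (by simp)⟩
    rw [← hS' s hs]
    exact (congrArg ρ (hS' s hs)).trans
      (hρ' (Sum.inl s) (Finset.inl_mem_disjSum.2 (Finset.mem_coe.1 hs)))
  · let σ : ℕ ⊕ Fin k × ZMod m → ℕ ⊕ Fin k × ZMod m := fun x => Multiplicative.ofAdd (1 : ZMod m) • x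
    have hσ : IsEmbeddingOn M M (S.disjSum Finset.univ) σ := by
      refine ⟨(MulAction.injective _).injOn, fun Z _ _ => ?_⟩
      have := hM (Multiplicative.ofAdd (1 : ZMod m)) Z
      rw [← Finset.image_smul, ← Finset.image_smul] at this
      exact this
    obtain ⟨π, hπ, hπ'⟩ := hF.exists_aut hh (hσ.comp hh (by
      intro y hy
      obtain ⟨x, hx, rfl⟩ := Finset.mem_image.1 hy
      rcases x with x | x
      · exact hx
      · exact Finset.inr_mem_disjSum.2 (Finset.mem_univ _)))
    refine ⟨π, ⟨hπ, fun s hs => ?_⟩, fun i j => ?_⟩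
    · have := hπ' (Sum.inl s) (Finset.inl_mem_disjSum.2 (Finset.mem_coe.1 hs))
      rw [hS' s hs] at this
      exact this.trans (hS' s hs)
    · exact hπ' (Sum.inr (i, j)) (by simp)

/-- A new point `none` is to look like `e` over `S ∪ {d}` and like `ρ e` over `S ∪ {d'}`. As `d ≠
d'`, the two requirements overlap only in `S ∪ {none}`, where `ρ` matches them. Hence some model
satisfies both, and `b` realizes `none` in `F`. -/
theorem IsGeneric.amalgamation {F : SelModel m ℕ} (hF : F.IsGeneric) {S : Finset ℕ} {d d' e : ℕ}
    (hne : d ≠ d') (he : e ∉ insert d S) {ρ : Equiv.Perm ℕ}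
    (hρ : ρ ∈ AtomSet.fixing F.aut (S : Set ℕ)) (he' : ρ e ∉ insert d' S) :
    ∃ b, (∃ α ∈ AtomSet.fixing F.aut ((insert d S : Finset ℕ) : Set ℕ), α e = b) ∧
      ∃ β ∈ AtomSet.fixing F.aut ((insert d' S : Finset ℕ) : Set ℕ), β (ρ e) = b := by
  let Z : Fin 3 → Finset (Option ℕ) := ![(insert d (insert d' S)).map .some,
    Finset.insertNone (insert d S), Finset.insertNone (insert d' S)]
  let q : Fin 3 → Option ℕ → ℕ := ![(·.getD 0), (·.getD e), (·.getD (ρ e))]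
  have hinj : ∀ (B : Finset ℕ) (x : ℕ), x ∉ B →
      Set.InjOn (fun o : Option ℕ => o.getD x) (Finset.insertNone B) := by
    rintro B x hx (_ | y) hy (_ | z) hz h
    · rfl
    · have h' : x = z := h
      exact absurd (Finset.some_mem_insertNone.1 hz) (h' ▸ hx)
    · have h' : y = x := h
      exact absurd (Finset.some_mem_insertNone.1 hy) (h' ▸ hx)
    · exact congrArg some h
  obtain ⟨M, hM⟩ := exists_isEmbeddingOn_of_agree F Z q (by
    intro i
    fin_cases i
    · intro x hx y hy h
      obtain ⟨x, -, rfl⟩ := Finset.mem_map.1 (Finset.mem_coe.1 hx)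
      obtain ⟨y, -, rfl⟩ := Finset.mem_map.1 (Finset.mem_coe.1 hy)
      exact congrArg some h
    · exact hinj _ _ he
    · exact hinj _ _ he') (by
    have h0 : ∀ x ∈ Z 0, ∀ y z : ℕ, x.getD y = x.getD z := by
      intro x hx y z
      obtain ⟨x, -, rfl⟩ := Finset.mem_map.1 hx
      rfl
    intro i j hij
    fin_cases i <;> fin_cases j
    all_goals first | exact absurd hij (by decide) | skip
    · exact ⟨1, F.aut.one_mem, fun x hx _ => h0 x hx _ _⟩
    · exact ⟨1, F.aut.one_mem, fun x hx _ => h0 x hx _ _⟩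
    · refine ⟨ρ, hρ.1, ?_⟩
      rintro (_ | x) hx hx'
      · rfl
      · have h1 : x ∈ insert d S := Finset.some_mem_insertNone.1 hx
        have h2 : x ∈ insert d' S := Finset.some_mem_insertNone.1 hx'
        have h3 : x ∈ S := by
          rcases Finset.mem_insert.1 h1 with rfl | h1
          · exact (Finset.mem_insert.1 h2).resolve_left hne
          · exact h1
        exact (hρ.2 x (Finset.mem_coe.2 h3)).symm)
  have hM0 : IsEmbeddingOn M F ((insert d (insert d' S)).map .some) (·.getD 0) := hM 0
  have hM1 : IsEmbeddingOn M F (Finset.insertNone (insert d S)) (·.getD e) := hM 1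
  have hM2 : IsEmbeddingOn M F (Finset.insertNone (insert d' S)) (·.getD (ρ e)) := hM 2
  obtain ⟨h, hh, hid⟩ := hF.exists_extension hM0
    (A := Finset.insertNone (insert d (insert d' S))) (by
      intro x hx
      obtain ⟨y, hy, rfl⟩ := Finset.mem_map.1 hx
      exact Finset.some_mem_insertNone.2 hy)
  have hid' : ∀ x ∈ insert d (insert d' S), h (some x) = x := fun x hx =>
    hid _ (Finset.mem_map_of_mem _ hx)
  have key : ∀ (B : Finset ℕ) (x : ℕ), B ⊆ insert d (insert d' S) →
      IsEmbeddingOn M F (Finset.insertNone B) (·.getD x) →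
      ∃ α ∈ AtomSet.fixing F.aut (B : Set ℕ), α x = h none := by
    intro B x hB hBx
    obtain ⟨α, hα, hα'⟩ := hF.exists_aut hBx (hh.mono (Finset.insertNone.monotone hB))
    refine ⟨α, ⟨hα, fun y hy => ?_⟩, hα' none (Finset.none_mem_insertNone)⟩
    exact (hα' (some y) (Finset.some_mem_insertNone.2 (Finset.mem_coe.1 hy))).trans
      (hid' y (hB (Finset.mem_coe.1 hy)))
  exact ⟨h none, key _ _ (Finset.insert_subset_insert _ (Finset.subset_insert _ _)) hM1,
    key _ _ (Finset.subset_insert _ _) hM2⟩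

end SelModel

/-! ### Comprehension and the group action in the universe of sets with atoms -/

namespace AtomSet

variable {A : Type u}

theorem not_mem_atom (x : AtomSet A) (a : A) : ¬ Mem x (atom a) := by
  induction x using Quotient.inductionOn
  exact id

theorem not_isAtom_of_mem {x y : AtomSet A} (h : Mem x y) : ¬ IsAtom y := by
  induction x using Quotient.inductionOn
  induction y using Quotient.inductionOn with | h y
  cases y
  · exact h.elim
  · exact id

theorem atom_injective : Function.Injective (atom : A → AtomSet A) :=
  fun _ _ h => Quotient.exact h

theorem mem_atoms {x : AtomSet A} : Mem x (atoms A) ↔ ∃ a, x = atom a := by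
  induction x using Quotient.inductionOn
  exact exists_congr fun a => (Quotient.eq (r := PreAtomSet.setoid A)).symm

theorem ext_of_not_isAtom {x y : AtomSet A} (hx : ¬ IsAtom x) (hy : ¬ IsAtom y)
    (h : ∀ z, Mem z x ↔ Mem z y) : x = y := by
  induction x using Quotient.inductionOn with | h x
  induction y using Quotient.inductionOn with | h y
  cases x with
  | atom a => exact absurd trivial hx
  | mk ι f =>
    cases y with
    | atom a => exact absurd trivial hy
    | mk κ g =>
      refine Quotient.sound ⟨fun i => ?_, fun j => ?_⟩
      · exact (h (Quotient.mk _ (f i))).1 ⟨i, PreAtomSet.Equiv.refl _⟩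
      · obtain ⟨i, hi⟩ := (h (Quotient.mk _ (g j))).2 ⟨j, PreAtomSet.Equiv.refl _⟩
        exact ⟨i, PreAtomSet.Equiv.symm hi⟩

instance small_setOf_mem (x : AtomSet A) : Small.{u} {z | Mem z x} := by
  induction x using Quotient.inductionOn with | h x
  cases x with
  | atom a =>
    have : IsEmpty {z | Mem z (Quotient.mk _ (PreAtomSet.atom a))} :=
      ⟨fun z => not_mem_atom z.1 a z.2⟩
    infer_instance
  | mk ι f =>
    refine small_of_surjective (α := ι)
      (f := fun i => ⟨Quotient.mk _ (f i), ⟨i, PreAtomSet.Equiv.refl _⟩⟩) ?_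
    rintro ⟨z, hz⟩
    induction z using Quotient.inductionOn
    obtain ⟨i, hi⟩ := hz
    exact ⟨i, Subtype.ext (Quotient.sound (PreAtomSet.Equiv.symm hi))⟩

/-- A small collection can be indexed in universe `u`, and a family of representing codes is itself
a code. -/
theorem exists_set (s : Set (AtomSet A)) [Small.{u} s] :
    ∃ x, ¬ IsAtom x ∧ ∀ z, Mem z x ↔ z ∈ s := by
  let f : Shrink.{u} s → AtomSet A := fun i => ((equivShrink s).symm i).1
  refine ⟨Quotient.mk _ (PreAtomSet.mk (Shrink.{u} s) fun i => (f i).out), id, fun z => ?_⟩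
  induction z using Quotient.inductionOn with | h z
  constructor
  · rintro ⟨i, hi⟩
    have h := (Quotient.mk_eq_iff_out (s := PreAtomSet.setoid A)).2 hi
    exact h ▸ ((equivShrink s).symm i).2
  · intro hz
    refine ⟨equivShrink s ⟨_, hz⟩, ?_⟩
    refine (Quotient.mk_eq_iff_out (s := PreAtomSet.setoid A)).1 ?_
    simp [f]

instance : MulAction (Equiv.Perm A) (AtomSet A) where
  smul := perm
  one_smul x := by
    induction x using Quotient.inductionOn with | h x
    refine congrArg (Quotient.mk _) ?_
    induction x with
    | atom a => rfl
    | mk ι f ih => exact congrArg (PreAtomSet.mk ι) (funext ih)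
  mul_smul π ρ x := by
    induction x using Quotient.inductionOn with | h x
    refine congrArg (Quotient.mk _) ?_
    induction x with
    | atom a => rfl
    | mk ι f ih => exact congrArg (PreAtomSet.mk ι) (funext ih)

theorem mem_smul_of_mem (π : Equiv.Perm A) {x y : AtomSet A} (h : Mem x y) :
    Mem (π • x) (π • y) := by
  induction x using Quotient.inductionOn
  induction y using Quotient.inductionOn with | h y
  cases y with
  | atom a => exact h
  | mk ι f => exact h.imp fun i hi => PreAtomSet.perm_congr π hi

theorem mem_smul_iff (π : Equiv.Perm A) {x y : AtomSet A} :
    Mem (π • x) (π • y) ↔ Mem x y := by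
  refine ⟨fun h => ?_, mem_smul_of_mem π⟩
  have := mem_smul_of_mem π⁻¹ h
  rwa [inv_smul_smul, inv_smul_smul] at this

theorem isAtom_smul_iff (π : Equiv.Perm A) {x : AtomSet A} : IsAtom (π • x) ↔ IsAtom x := by
  induction x using Quotient.inductionOn with | h x
  cases x <;> exact Iff.rfl

/-- If `S` supports `x`, then `π(S)` supports `π x`: conjugation by `π ∈ G` turns permutations
fixing `π(S)` into permutations fixing `S`. -/
theorem HereditarilySymmetric.smul {G : Subgroup (Equiv.Perm A)} {π : Equiv.Perm A} (hπ : π ∈ G)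
    {x : AtomSet A} (h : HereditarilySymmetric G x) : HereditarilySymmetric G (π • x) := by
  induction h with
  | intro x hx _ ih =>
    refine .intro _ ?_ fun y hy => ?_
    · obtain ⟨S, hS⟩ := hx
      refine ⟨S.map π.toEmbedding, fun ρ hρ => ?_⟩
      have h1 : (π⁻¹ * ρ * π) • x = x := by
        refine hS _ ⟨G.mul_mem (G.mul_mem (G.inv_mem hπ) hρ.1) hπ, fun a ha => ?_⟩
        have h2 : ρ (π a) = π a := hρ.2 (π a) (by simpa using ha)
        change π⁻¹ (ρ (π a)) = a
        rw [h2]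
        exact π.symm_apply_apply a
      rw [mul_smul, mul_smul, inv_smul_eq_iff] at h1
      exact h1
    · have h1 : Mem (π⁻¹ • y) x := by
        rwa [← mem_smul_iff π, smul_inv_smul]
      have := ih _ h1
      rwa [smul_inv_smul] at this

end AtomSet

/-! ### Kuratowski pairs -/

namespace SetStructure

variable {M : SetStructure.{u}}

theorem IsPair.injective {p a b a' b' : M.Obj} (h : M.IsPair p a b) (h' : M.IsPair p a' b') :
    a = a' ∧ b = b' := by
  obtain ⟨s, t, hs, ht, hp⟩ := h
  obtain ⟨s', t', hs', ht', hp'⟩ := h'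
  have h1 : s = s' ∨ s = t' := (hp' s).1 ((hp s).2 (.inl rfl))
  have h2 : t = s' ∨ t = t' := (hp' t).1 ((hp t).2 (.inr rfl))
  have h3 : t' = s ∨ t' = t := (hp t').1 ((hp' t').2 (.inr rfl))
  have ha : a = a' := by
    rcases h1 with rfl | rfl
    · exact (hs' a).1 ((hs a).2 rfl)
    · exact ((hs a').1 ((ht' a').2 (.inl rfl))).symm
  subst ha
  refine ⟨rfl, ?_⟩
  have hb : b = a ∨ b = b' := by
    rcases h2 with rfl | rfl
    · exact .inl ((hs' b).1 ((ht b).2 (.inr rfl)))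
    · exact (ht' b).1 ((ht b).2 (.inr rfl))
  have hb' : b' = a ∨ b' = b := by
    rcases h3 with rfl | rfl
    · exact .inl ((hs b').1 ((ht' b').2 (.inr rfl)))
    · exact (ht b').1 ((ht' b').2 (.inr rfl))
  rcases hb with rfl | rfl
  · rcases hb' with rfl | rfl <;> rfl
  · rfl

end SetStructure

/-! ### The permutation model as a set with group action; recognizing its sets and functions -/

namespace permutationModel

variable {A : Type u} {G : Subgroup (Equiv.Perm A)}

/-- The group acts on the permutation model by automorphisms. -/
instance : MulAction G (permutationModel G).Obj where
  smul π x := ⟨π.1 • x.1, x.2.smul π.2⟩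
  one_smul x := Subtype.ext (one_smul _ x.1)
  mul_smul π ρ x := Subtype.ext (mul_smul π.1 ρ.1 x.1)

theorem mem_smul_smul_iff (π : G) {x y : (permutationModel G).Obj} :
    (permutationModel G).mem (π • x) (π • y) ↔ (permutationModel G).mem x y :=
  AtomSet.mem_smul_iff π.1

theorem mem_smul_iff (π : G) {x y : (permutationModel G).Obj} :
    (permutationModel G).mem x (π • y) ↔ (permutationModel G).mem (π⁻¹ • x) y := by
  rw [← mem_smul_smul_iff π (x := π⁻¹ • x), smul_inv_smul]

theorem isAtom_smul_iff (π : G) {x : (permutationModel G).Obj} :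
    (permutationModel G).isAtom (π • x) ↔ (permutationModel G).isAtom x :=
  AtomSet.isAtom_smul_iff π.1

theorem not_isAtom_of_mem {x y : (permutationModel G).Obj} (h : (permutationModel G).mem x y) :
    ¬ (permutationModel G).isAtom y :=
  AtomSet.not_isAtom_of_mem h

theorem hereditarilySymmetric_of_mem {x y : AtomSet A}
    (hy : AtomSet.HereditarilySymmetric G y) (h : AtomSet.Mem x y) :
    AtomSet.HereditarilySymmetric G x := by
  obtain ⟨_, _, hy⟩ := hy
  exact hy x h

theorem ext_of_not_isAtom {x y : (permutationModel G).Obj} (hx : ¬ (permutationModel G).isAtom x)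
    (hy : ¬ (permutationModel G).isAtom y)
    (h : ∀ z, (permutationModel G).mem z x ↔ (permutationModel G).mem z y) : x = y :=
  Subtype.ext (AtomSet.ext_of_not_isAtom hx hy fun z =>
    ⟨fun hz => (h ⟨z, hereditarilySymmetric_of_mem x.2 hz⟩).1 hz,
      fun hz => (h ⟨z, hereditarilySymmetric_of_mem y.2 hz⟩).2 hz⟩)

/-- The permutation `π` fixes every element of `S`. -/
def Fixes (S : Finset A) (π : G) : Prop :=
  ∀ a ∈ S, π.1 a = a

theorem Fixes.inv {S : Finset A} {π : G} (h : Fixes S π) : Fixes S π⁻¹ := fun a ha => by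
  conv_lhs => rw [← h a ha]
  exact π.1.symm_apply_apply a

theorem Fixes.mono {S T : Finset A} {π : G} (h : Fixes T π) (hST : S ⊆ T) : Fixes S π :=
  fun a ha => h a (hST ha)

theorem Fixes.mul {S : Finset A} {π ρ : G} (h : Fixes S π) (h' : Fixes S ρ) : Fixes S (π * ρ) :=
  fun a ha => (congrArg π.1 (h' a ha)).trans (h a ha)

/-- Every permutation in the group that fixes `S` pointwise fixes `x`. -/
def SupportedBy (S : Finset A) (x : (permutationModel G).Obj) : Prop :=
  ∀ π : G, Fixes S π → π • x = x

theorem SupportedBy.mono {S T : Finset A} {x : (permutationModel G).Obj} (h : SupportedBy S x)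
    (hST : S ⊆ T) : SupportedBy T x :=
  fun π hπ => h π (hπ.mono hST)

theorem exists_supportedBy (x : (permutationModel G).Obj) : ∃ S, SupportedBy S x := by
  obtain ⟨x, _, ⟨S, hS⟩, _⟩ := x
  exact ⟨S, fun π hπ => Subtype.ext (hS π.1 ⟨π.2, hπ⟩)⟩

instance small_ext (x : (permutationModel G).Obj) : Small.{u} ((permutationModel G).ext x) :=
  small_of_injective (β := {z | AtomSet.Mem z x.1}) (f := fun z => ⟨z.1.1, z.2⟩)
    fun _ _ h => Subtype.ext (Subtype.ext (congrArg (fun v => v.1) h))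

/-- Comprehension in the permutation model. Closure under `fix(S)` makes `S` a support, since
`fix(S)` is closed under inverses, and all elements are hereditarily symmetric already. -/
theorem exists_ext_eq (s : Set (permutationModel G).Obj) [Small.{u} s] (S : Finset A)
    (hS : ∀ π : G, Fixes S π → ∀ x ∈ s, π • x ∈ s) :
    ∃ x, ¬ (permutationModel G).isAtom x ∧ (permutationModel G).ext x = s := by
  obtain ⟨x, hx, hmem⟩ := AtomSet.exists_set ((fun z : (permutationModel G).Obj => z.1) '' s)
  have hsub : ∀ π : G, Fixes S π → ∀ z, AtomSet.Mem z x → AtomSet.Mem (π.1 • z) x := by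
    intro π hπ z hz
    obtain ⟨w, hw, rfl⟩ := (hmem z).1 hz
    exact (hmem _).2 ⟨_, hS π hπ w hw, rfl⟩
  have hH : AtomSet.HereditarilySymmetric G x := by
    refine .intro x ⟨S, fun π hπ => ?_⟩ fun y hy => ?_
    · have hf : Fixes S (⟨π, hπ.1⟩ : G) := hπ.2
      refine AtomSet.ext_of_not_isAtom ((AtomSet.isAtom_smul_iff π).not.2 hx) hx fun z => ?_
      constructor
      · intro hz
        have h1 : AtomSet.Mem (π⁻¹ • z) x := by
          rw [← AtomSet.mem_smul_iff π, smul_inv_smul]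
          exact hz
        have h2 := hsub _ hf _ h1
        rwa [smul_inv_smul] at h2
      · intro hz
        have h1 := hsub _ hf.inv _ hz
        change AtomSet.Mem z (π • x)
        rw [← AtomSet.mem_smul_iff π⁻¹, inv_smul_smul]
        exact h1
    · obtain ⟨w, -, rfl⟩ := (hmem y).1 hy
      exact w.2
  refine ⟨⟨x, hH⟩, hx, Set.ext fun z => ?_⟩
  refine (hmem z.1).trans ⟨?_, fun h => ⟨z, h, rfl⟩⟩
  rintro ⟨w, hw, e⟩
  rwa [← Subtype.ext e]

theorem exists_ext_eq_finset (s : Finset (permutationModel G).Obj) :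
    ∃ x, ¬ (permutationModel G).isAtom x ∧ (permutationModel G).ext x = s := by
  classical
  choose S hS using exists_supportedBy (G := G)
  refine exists_ext_eq (s : Set (permutationModel G).Obj) (s.biUnion S) fun π hπ x hx => ?_
  rwa [hS x π (hπ.mono (Finset.subset_biUnion_of_mem S hx))]

theorem exists_isPair (a b : (permutationModel G).Obj) : ∃ p, (permutationModel G).IsPair p a b := by
  classical
  obtain ⟨s, -, hs⟩ := exists_ext_eq_finset {a}
  obtain ⟨t, -, ht⟩ := exists_ext_eq_finset {a, b}
  obtain ⟨p, -, hp⟩ := exists_ext_eq_finset {s, t}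
  refine ⟨p, s, t, fun c => ?_, fun c => ?_, fun c => ?_⟩
  · exact (Set.ext_iff.1 hs c).trans (by simp)
  · exact (Set.ext_iff.1 ht c).trans (by simp)
  · exact (Set.ext_iff.1 hp c).trans (by simp)

theorem isPair_unique {p p' a b : (permutationModel G).Obj} (h : (permutationModel G).IsPair p a b)
    (h' : (permutationModel G).IsPair p' a b) : p = p' := by
  obtain ⟨s, t, hs, ht, hp⟩ := h
  obtain ⟨s', t', hs', ht', hp'⟩ := h'
  have e1 : s = s' := ext_of_not_isAtom (not_isAtom_of_mem ((hs a).2 rfl))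
    (not_isAtom_of_mem ((hs' a).2 rfl)) fun z => (hs z).trans (hs' z).symm
  have e2 : t = t' := ext_of_not_isAtom (not_isAtom_of_mem ((ht a).2 (.inl rfl)))
    (not_isAtom_of_mem ((ht' a).2 (.inl rfl))) fun z => (ht z).trans (ht' z).symm
  subst e1 e2
  exact ext_of_not_isAtom (not_isAtom_of_mem ((hp s).2 (.inl rfl)))
    (not_isAtom_of_mem ((hp' s).2 (.inl rfl))) fun z => (hp z).trans (hp' z).symm

theorem isPair_smul (π : G) {p a b : (permutationModel G).Obj}
    (h : (permutationModel G).IsPair p a b) :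
    (permutationModel G).IsPair (π • p) (π • a) (π • b) := by
  obtain ⟨s, t, hs, ht, hp⟩ := h
  refine ⟨π • s, π • t, fun c => ?_, fun c => ?_, fun c => ?_⟩
  · rw [mem_smul_iff, hs, inv_smul_eq_iff]
  · rw [mem_smul_iff, ht, inv_smul_eq_iff, inv_smul_eq_iff]
  · rw [mem_smul_iff, hp, inv_smul_eq_iff, inv_smul_eq_iff]

theorem maps_smul (π : G) {f a b : (permutationModel G).Obj}
    (h : (permutationModel G).Maps f a b) :
    (permutationModel G).Maps (π • f) (π • a) (π • b) := by
  obtain ⟨p, hp, hab⟩ := h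
  exact ⟨π • p, (mem_smul_smul_iff π).2 hp, isPair_smul π hab⟩

theorem ext_smul (π : G) (z : (permutationModel G).Obj) :
    (permutationModel G).ext (π • z) = (π • ·) '' (permutationModel G).ext z := by
  ext c
  constructor
  · intro h
    exact ⟨π⁻¹ • c, (mem_smul_iff π).1 h, smul_inv_smul π c⟩
  · rintro ⟨d, hd, rfl⟩
    exact (mem_smul_smul_iff π).2 hd

theorem finSubsetGT_smul (π : G) {n : ℕ} {z y : (permutationModel G).Obj}
    (h : (permutationModel G).FinSubsetGT n z y) :
    (permutationModel G).FinSubsetGT n (π • z) (π • y) := by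
  obtain ⟨⟨h1, h2⟩, h3, h4⟩ := h
  refine ⟨⟨(isAtom_smul_iff π).not.2 h1, fun t ht => ?_⟩, ?_, ?_⟩
  · rw [mem_smul_iff] at ht ⊢
    exact h2 _ ht
  · rw [ext_smul]
    exact h3.image _
  · rw [ext_smul, Set.ncard_image_of_injective _ (MulAction.injective π)]
    exact h4

/-- A subset of `y` is determined by its trace on the small type of elements of `y`. This smallness
lets the graph of a selection function be a set. -/
instance small_finSubsetGT (n : ℕ) (y : (permutationModel G).Obj) :
    Small.{u} {z | (permutationModel G).FinSubsetGT n z y} := by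
  refine small_of_injective (β := Set ((permutationModel G).ext y))
    (f := fun z => {w | (permutationModel G).mem w.1 z.1}) fun z z' h => ?_
  refine Subtype.ext (ext_of_not_isAtom z.2.1.1 z'.2.1.1 fun w => ?_)
  constructor
  · intro hw
    exact (Set.ext_iff.1 h ⟨w, z.2.1.2 w hw⟩).1 hw
  · intro hw
    exact (Set.ext_iff.1 h ⟨w, z'.2.1.2 w hw⟩).2 hw

/-- A map that commutes with the pointwise stabilizer of a finite set of atoms belongs to the
permutation model. -/
theorem exists_isFunction {D C : (permutationModel G).Obj → Prop} [Small.{u} {a | D a}]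
    (φ : (permutationModel G).Obj → (permutationModel G).Obj) (S : Finset A)
    (hD : ∀ π : G, Fixes S π → ∀ a, D a → D (π • a))
    (hφ : ∀ π : G, Fixes S π → ∀ a, D a → φ (π • a) = π • φ a) (hC : ∀ a, D a → C (φ a)) :
    ∃ f, (permutationModel G).IsFunction f D C ∧
      ∀ a b, (permutationModel G).Maps f a b → D a ∧ b = φ a := by
  choose pair hpair using fun a => exists_isPair a (φ a)
  have : Small.{u} (pair '' {a | D a}) := inferInstance
  obtain ⟨f, hf, hext⟩ := exists_ext_eq (pair '' {a | D a}) S (by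
    rintro π hπ _ ⟨a, ha, rfl⟩
    refine ⟨π • a, hD π hπ a ha, ?_⟩
    have h := isPair_smul π (hpair a)
    rw [← hφ π hπ a ha] at h
    exact isPair_unique (hpair _) h)
  have hmem : ∀ p, (permutationModel G).mem p f ↔ ∃ a, D a ∧ pair a = p := Set.ext_iff.1 hext
  have hmaps : ∀ a b, (permutationModel G).Maps f a b → D a ∧ b = φ a := by
    rintro a b ⟨p, hp, hab⟩
    obtain ⟨c, hc, rfl⟩ := (hmem p).1 hp
    obtain ⟨rfl, rfl⟩ := hab.injective (hpair c)
    exact ⟨hc, rfl⟩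
  refine ⟨f, ⟨hf, fun p hp => ?_, fun a ha => ?_⟩, hmaps⟩
  · obtain ⟨a, ha, rfl⟩ := (hmem p).1 hp
    exact ⟨a, φ a, ha, hC a ha, hpair a⟩
  · exact ⟨φ a, ⟨pair a, (hmem _).2 ⟨a, ha, rfl⟩, hpair a⟩, fun b hb => (hmaps a b hb).2⟩

/-- A selection function on an infinite family of elements of `x` that commutes with the pointwise
stabilizer of a finite set of atoms witnesses partial selection for `x` in the permutation model. -/
theorem hasPartialSelection_of_sel {m : ℕ} {x : (permutationModel G).Obj}
    {Y : Set (permutationModel G).Obj} (hYx : Y ⊆ (permutationModel G).ext x) (hinf : Y.Infinite)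
    {S : Finset A} (hY : ∀ π : G, Fixes S π → ∀ y ∈ Y, π • y ∈ Y)
    (sel : Finset (permutationModel G).Obj → Finset (permutationModel G).Obj)
    (hsel : ∀ Z : Finset (permutationModel G).Obj, ↑Z ⊆ Y → m < Z.card →
      sel Z ⊆ Z ∧ (sel Z).card = m ∧ ∀ π : G, Fixes S π →
        sel (Z.map (MulAction.toPerm π).toEmbedding) =
          (sel Z).map (MulAction.toPerm π).toEmbedding) :
    (permutationModel G).HasPartialSelection m x := by
  classical
  have : Small.{u} Y := small_subset hYx
  obtain ⟨y, hy, hyY⟩ := exists_ext_eq Y S hY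
  choose set hset hset' using exists_ext_eq_finset (G := G)
  have hyS : SupportedBy S y := fun π hπ =>
    ext_of_not_isAtom ((isAtom_smul_iff π).not.2 hy) hy fun z => by
      change z ∈ (permutationModel G).ext (π • y) ↔ z ∈ (permutationModel G).ext y
      rw [ext_smul, hyY]
      constructor
      · rintro ⟨w, hw, rfl⟩
        exact hY π hπ w hw
      · intro hz
        exact ⟨π⁻¹ • z, hY _ hπ.inv z hz, smul_inv_smul π z⟩
  -- The default value at infinite `z` is irrelevant, since only finite subsets of `y` belong to the
  -- domain.
  let φ : (permutationModel G).Obj → (permutationModel G).Obj := fun z =>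
    if h : ((permutationModel G).ext z).Finite then set (sel h.toFinset) else z
  have hφ : ∀ (z) (Z : Finset (permutationModel G).Obj), (permutationModel G).ext z = ↑Z →
      φ z = set (sel Z) := by
    intro z Z h
    have hf : ((permutationModel G).ext z).Finite := h ▸ Z.finite_toSet
    have hZ : hf.toFinset = Z := Finset.coe_injective (by rw [hf.coe_toFinset, h])
    exact (dif_pos hf).trans (by rw [hZ])
  have hfin : ∀ z, (permutationModel G).FinSubsetGT m z y →
      ∃ Z : Finset (permutationModel G).Obj, (permutationModel G).ext z = ↑Z ∧ ↑Z ⊆ Y ∧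
        m < Z.card := by
    rintro z ⟨h1, h2, h3⟩
    refine ⟨h2.toFinset, h2.coe_toFinset.symm, ?_, ?_⟩
    · rw [h2.coe_toFinset, ← hyY]
      exact h1.2
    · rwa [Set.ncard_eq_toFinset_card _ h2] at h3
  obtain ⟨f, hf, hmaps⟩ := exists_isFunction
    (D := fun z => (permutationModel G).FinSubsetGT m z y)
    (C := fun w => (permutationModel G).SubsetCard m w y) φ S
    (fun π hπ z hz => by
      have := finSubsetGT_smul π hz
      rwa [hyS π hπ] at this)
    (fun π hπ z hz => by
      obtain ⟨Z, h1, h2, h3⟩ := hfin z hz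
      have h4 : (permutationModel G).ext (π • z) =
          ↑(Z.map (MulAction.toPerm π).toEmbedding) := by
        rw [ext_smul, h1, Finset.coe_map]
        rfl
      rw [hφ z Z h1, hφ _ _ h4, (hsel Z h2 h3).2.2 π hπ]
      refine ext_of_not_isAtom (hset _) ((isAtom_smul_iff π).not.2 (hset _)) fun w => ?_
      refine Set.ext_iff.1 (?_ : (permutationModel G).ext _ = (permutationModel G).ext _) w
      rw [ext_smul, hset', hset', Finset.coe_map]
      rfl)
    (fun z hz => by
      obtain ⟨Z, h1, h2, h3⟩ := hfin z hz
      obtain ⟨h4, h5, -⟩ := hsel Z h2 h3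
      rw [hφ z Z h1]
      refine ⟨⟨hset _, fun t ht => ?_⟩, ?_, ?_⟩
      · have ht' : t ∈ (permutationModel G).ext (set (sel Z)) := ht
        rw [hset'] at ht'
        change t ∈ (permutationModel G).ext y
        rw [hyY]
        exact h2 (h4 ht')
      · rw [hset']
        exact Finset.finite_toSet _
      · rw [hset', Set.ncard_coe_finset, h5])
  refine ⟨y, ⟨hy, fun t ht => ?_⟩, hyY ▸ hinf, f, hf, fun z w hzw => ?_⟩
  · have ht' : t ∈ (permutationModel G).ext y := ht
    rw [hyY] at ht'
    exact hYx ht'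
  · obtain ⟨hz, rfl⟩ := hmaps z w hzw
    obtain ⟨Z, h1, h2, h3⟩ := hfin z hz
    rw [hφ z Z h1]
    refine ⟨hset _, fun t ht => ?_⟩
    have ht' : t ∈ (permutationModel G).ext (set (sel Z)) := ht
    rw [hset'] at ht'
    change t ∈ (permutationModel G).ext z
    rw [h1]
    exact (hsel Z h2 h3).1 ht'

end permutationModel

namespace permutationModel

variable {A : Type u} {G : Subgroup (Equiv.Perm A)}

/-- The atom `a` as an object of the permutation model. -/
def atom (G : Subgroup (Equiv.Perm A)) (a : A) : (permutationModel G).Obj :=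
  ⟨AtomSet.atom a, AtomSet.hereditarilySymmetric_atom G a⟩

theorem atom_injective : Function.Injective (atom G) := fun _ _ h =>
  AtomSet.atom_injective (congrArg (fun x => x.1) h)

theorem smul_atom (π : G) (a : A) : π • atom G a = atom G (π.1 a) :=
  rfl

theorem mem_atoms {x : (permutationModel G).Obj} :
    (permutationModel G).mem x (atoms G) ↔ ∃ a, x = atom G a :=
  AtomSet.mem_atoms.trans (exists_congr fun _ =>
    ⟨fun h => Subtype.ext h, fun h => congrArg (fun x => x.1) h⟩)

theorem infinite_ext_atoms [Infinite A] : ((permutationModel G).ext (atoms G)).Infinite := by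
  refine (Set.infinite_range_of_injective (atom_injective (G := G))).mono ?_
  rintro _ ⟨a, rfl⟩
  exact (mem_atoms (G := G)).2 ⟨a, rfl⟩

/-- An object that is not supported by `S` has a support `insert a S'` such that `S'` includes `S`
and is not a support. -/
theorem exists_supportedBy_insert [DecidableEq A] {S : Finset A} {z : (permutationModel G).Obj}
    (hz : ¬ SupportedBy S z) :
    ∃ S', S ⊆ S' ∧ ∃ a ∉ S', ¬ SupportedBy S' z ∧ SupportedBy (insert a S') z := by
  obtain ⟨T, hT⟩ := exists_supportedBy z
  replace hT : SupportedBy (T ∪ S) z := hT.mono Finset.subset_union_left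
  -- Discard points of the support `T ∪ S` one at a time; the first one whose removal destroys the
  -- support is `a`.
  induction T using Finset.induction_on with
  | empty => exact absurd (by simpa using hT) hz
  | insert a T _ ih =>
    rw [Finset.insert_union] at hT
    by_cases h : SupportedBy (T ∪ S) z
    · exact ih h
    · refine ⟨T ∪ S, Finset.subset_union_right, a, fun ha => h ?_, h, hT⟩
      rwa [Finset.insert_eq_of_mem ha] at hT

end permutationModel

/-! ### Failure of selection for `n` and success for `m` in `MOD_m` -/

namespace SelModel

open permutationModel

variable {m : ℕ} {F : SelModel m ℕ}

/-- The cycles lie in the `fix(S)`-orbit of a point of `Y` outside `S`, and this orbit stays in `Y`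
and avoids `S`. -/
theorem IsGeneric.exists_cycles_mem (hF : F.IsGeneric) (hm : 0 < m) (S : Finset ℕ) {Y : Set ℕ}
    (hinf : Y.Infinite) (hY : ∀ π ∈ AtomSet.fixing F.aut (S : Set ℕ), π '' Y = Y) (k : ℕ) :
    ∃ c : Fin k × ZMod m → ℕ, Function.Injective c ∧ Set.range c ⊆ Y \ (S : Set ℕ) ∧
      ∃ π ∈ AtomSet.fixing F.aut (S : Set ℕ), ∀ i j, π (c (i, j)) = c (i, j + 1) := by
  obtain ⟨a, haY, haS⟩ := hinf.exists_notMem_finset S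
  obtain ⟨c, hc, horb, hπ⟩ := hF.exists_cycles hm S haS k
  refine ⟨c, hc, ?_, hπ⟩
  rintro _ ⟨i, rfl⟩
  obtain ⟨ρ, hρ, h⟩ := horb i
  refine ⟨hY ρ hρ ▸ ⟨a, haY, h⟩, fun hS => ?_⟩
  have h1 := hρ.2 _ hS
  rw [← h] at h1 hS
  exact haS (ρ.injective h1 ▸ hS)

/-- The orbit contains `k * m` distinct points for every `k`. -/
theorem IsGeneric.infinite_orbit (hF : F.IsGeneric) (hm : 0 < m) {S : Finset ℕ} {a : ℕ}
    (ha : a ∉ S) : {c | ∃ π : F.aut, Fixes S π ∧ π.1 a = c}.Infinite := by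
  intro hfin
  have : NeZero m := ⟨hm.ne'⟩
  obtain ⟨c, hc, horb, -⟩ := hF.exists_cycles hm S ha
    ({c | ∃ π : F.aut, Fixes S π ∧ π.1 a = c}.ncard + 1)
  have h1 : Set.range c ⊆ {c | ∃ π : F.aut, Fixes S π ∧ π.1 a = c} := by
    rintro _ ⟨i, rfl⟩
    obtain ⟨ρ, hρ, h⟩ := horb i
    exact ⟨⟨ρ, hρ.1⟩, hρ.2, h⟩
  have h2 := Set.ncard_le_ncard h1 hfin
  rw [← Set.image_univ, Set.ncard_image_of_injective _ hc, Set.ncard_univ, Nat.card_prod,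
    Nat.card_fin, Nat.card_zmod] at h2
  have := Nat.le_mul_of_pos_right ({c | ∃ π : F.aut, Fixes S π ∧ π.1 a = c}.ncard + 1) hm
  omega

/-- A set of pairs that is closed under translations of the second coordinate has a multiple of `m`
elements. -/
theorem dvd_card_of_translation_invariant {ι : Type*} [Fintype ι] [NeZero m]
    (V : Finset (ι × ZMod m)) (hV : ∀ i j, (i, j) ∈ V → (i, j + 1) ∈ V) : m ∣ V.card := by
  classical
  have hadd : ∀ i j (r : ℕ), (i, j) ∈ V → (i, j + r) ∈ V := by
    intro i j r h
    induction r with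
    | zero => simpa using h
    | succ r ih =>
      have := hV _ _ ih
      rwa [add_assoc, ← Nat.cast_succ] at this
  have hall : ∀ i j j', (i, j) ∈ V → (i, j') ∈ V := by
    intro i j j' h
    have := hadd i j (j' - j).val h
    rwa [ZMod.natCast_zmod_val, add_sub_cancel] at this
  have hprod : V = (Finset.univ.filter fun i => (i, 0) ∈ V) ×ˢ Finset.univ := by
    ext ⟨i, j⟩
    simp only [Finset.mem_product, Finset.mem_filter, Finset.mem_univ, true_and, and_true]
    exact ⟨hall i j 0, hall i 0 j⟩
  rw [hprod, Finset.card_product, Finset.card_univ, ZMod.card]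
  exact dvd_mul_left _ _

theorem IsGeneric.not_hasPartialSelection_atoms (hF : F.IsGeneric) (hm : 0 < m) {n : ℕ}
    (hdvd : ¬ m ∣ n) : ¬ (MOD F).HasPartialSelection n (permutationModel.atoms F.aut) := by
  classical
  rintro ⟨y, hyx, hinf, f, ⟨-, hpairs, hfun⟩, hsub⟩
  have : NeZero m := ⟨hm.ne'⟩
  obtain ⟨S₁, hS₁⟩ := exists_supportedBy y
  obtain ⟨S₂, hS₂⟩ := exists_supportedBy f
  have hy : SupportedBy (S₁ ∪ S₂) y := hS₁.mono Finset.subset_union_left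
  have hf : SupportedBy (S₁ ∪ S₂) f := hS₂.mono Finset.subset_union_right
  have hYinf : {a | (MOD F).mem (atom F.aut a) y}.Infinite := by
    refine fun hfin => hinf ((hfin.image (atom F.aut)).subset fun x hx => ?_)
    obtain ⟨a, rfl⟩ := mem_atoms.1 (hyx.2 x hx)
    exact ⟨a, hx, rfl⟩
  obtain ⟨a, haY, haS⟩ := hYinf.exists_notMem_finset (S₁ ∪ S₂)
  replace haY : (MOD F).mem (atom F.aut a) y := haY
  -- With `n + 1` cycles there are `(n + 1) * m > n` points, so their set lies in the domain of `f`.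
  obtain ⟨c, hc, horb, π, hπ, hcyc⟩ := hF.exists_cycles hm (S₁ ∪ S₂) haS (n + 1)
  let g : Fin (n + 1) × ZMod m → (MOD F).Obj := fun i => atom F.aut (c i)
  have hg : Function.Injective g := atom_injective.comp hc
  have hgy : ∀ i, (MOD F).mem (g i) y := by
    intro i
    obtain ⟨ρ, hρ, h⟩ := horb i
    have h1 := (mem_smul_smul_iff (⟨ρ, hρ.1⟩ : F.aut)).2 haY
    rw [hy ⟨ρ, hρ.1⟩ hρ.2, smul_atom] at h1
    have h2 : g i = atom F.aut (ρ a) := congrArg (atom F.aut) h.symm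
    rw [h2]
    exact h1
  let τ : F.aut := ⟨π, hπ.1⟩
  have hτ : Fixes (S₁ ∪ S₂) τ := hπ.2
  have hgτ : ∀ i j, τ • g (i, j) = g (i, j + 1) := fun i j => congrArg (atom F.aut) (hcyc i j)
  obtain ⟨z, hz, hzext⟩ := exists_ext_eq_finset (G := F.aut) (Finset.univ.image g)
  have hzmem : ∀ x, (MOD F).mem x z ↔ ∃ i, g i = x := fun x =>
    (Set.ext_iff.1 hzext x).trans (by simp)
  have hzy : (MOD F).FinSubsetGT n z y := by
    refine ⟨⟨hz, fun t ht => ?_⟩, ?_, ?_⟩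
    · obtain ⟨i, rfl⟩ := (hzmem t).1 ht
      exact hgy i
    · rw [hzext]
      exact Finset.finite_toSet _
    · rw [hzext, Set.ncard_coe_finset, Finset.card_image_of_injective _ hg, Finset.card_univ,
        Fintype.card_prod, Fintype.card_fin, ZMod.card]
      exact Nat.lt_of_lt_of_le (Nat.lt_succ_self n) (Nat.le_mul_of_pos_right _ hm)
  have hτz : τ • z = z := by
    refine ext_of_not_isAtom ((isAtom_smul_iff τ).not.2 hz) hz fun x => ?_
    rw [mem_smul_iff, hzmem, hzmem]
    constructor
    · rintro ⟨⟨i, j⟩, h⟩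
      refine ⟨(i, j + 1), ?_⟩
      rw [← hgτ, h, smul_inv_smul]
    · rintro ⟨⟨i, j⟩, rfl⟩
      refine ⟨(i, j - 1), ?_⟩
      rw [eq_inv_smul_iff, hgτ, sub_add_cancel]
  obtain ⟨w, hw, huniq⟩ := hfun z hzy
  -- Since `τ` fixes both `f` and `z`, uniqueness of the value at `z` makes it fixed as well; so it
  -- is a union of cycles.
  have hτw : τ • w = w := by
    have h := maps_smul τ hw
    rw [hf τ hτ, hτz] at h
    exact huniq _ h
  have hwz := hsub z w hw
  have hwn : (MOD F).SubsetCard n w y := by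
    obtain ⟨p, hp, hpzw⟩ := hw
    obtain ⟨z', w', -, hw', hp'⟩ := hpairs p hp
    rwa [(hpzw.injective hp').2]
  refine hdvd ?_
  let V : Finset (Fin (n + 1) × ZMod m) := Finset.univ.filter fun i => (MOD F).mem (g i) w
  have hwV : (MOD F).ext w = ((V.image g : Finset (MOD F).Obj) : Set (MOD F).Obj) := by
    ext x
    simp only [Finset.coe_image, Set.mem_image, Finset.mem_coe, V, Finset.mem_filter,
      Finset.mem_univ, true_and]
    constructor
    · intro hx
      obtain ⟨i, rfl⟩ := (hzmem x).1 (hwz.2 x hx)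
      exact ⟨i, hx, rfl⟩
    · rintro ⟨i, hi, rfl⟩
      exact hi
  have hcard : V.card = n := by
    have h := hwn.2.2
    rwa [hwV, Set.ncard_coe_finset, Finset.card_image_of_injective _ hg] at h
  rw [← hcard]
  refine dvd_card_of_translation_invariant V fun i j h => ?_
  simp only [V, Finset.mem_filter, Finset.mem_univ, true_and] at h ⊢
  have h1 := (mem_smul_smul_iff τ).2 h
  rwa [hτw, hgτ] at h1

/-- If `S` does not support `z` but `S ∪ {a}` does, then the atom `π a` is determined by `π z`, for
automorphisms `π` that fix `S` pointwise. -/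
theorem IsGeneric.apply_eq_of_smul_eq (hF : F.IsGeneric) {S : Finset ℕ} {a : ℕ} (ha : a ∉ S)
    {z : (MOD F).Obj} (hS : ¬ SupportedBy S z) (haS : SupportedBy (insert a S) z) {π π' : F.aut}
    (hπ : Fixes S π) (hπ' : Fixes S π') (h : π • z = π' • z) : π.1 a = π'.1 a := by
  have hdet : ∀ σ σ' : F.aut, Fixes S σ → Fixes S σ' → σ.1 a = σ'.1 a → σ • z = σ' • z := by
    intro σ σ' hσ hσ' e
    rw [← inv_smul_eq_iff, ← mul_smul]
    refine haS _ fun b hb => ?_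
    rcases Finset.mem_insert.1 hb with rfl | hb
    · change σ'.1⁻¹ (σ.1 b) = b
      rw [e]
      exact σ'.1.symm_apply_apply b
    · exact hσ'.inv.mul hσ b hb
  have hnot : ∀ σ : F.aut, Fixes S σ → ∀ b ∉ S, σ.1 b ∉ S := fun σ hσ b hb hb' =>
    hb (σ.1.injective (hσ _ hb') ▸ hb')
  by_contra hne
  obtain ⟨ρ, hρ, hρz⟩ : ∃ ρ : F.aut, Fixes S ρ ∧ ρ • z ≠ z := by
    simpa [SupportedBy] using hS
  let τ := π⁻¹ * π'
  have hτ : Fixes S τ := hπ.inv.mul hπ'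
  have hτz : τ • z = z := by rw [mul_smul, inv_smul_eq_iff, h]
  have hτa : τ.1 a ≠ a := fun e => hne (by
    have h1 : π.1 (τ.1 a) = π'.1 a := π.1.apply_symm_apply (π'.1 a)
    rw [← h1, e])
  have hρa : a ≠ ρ.1 a := fun e => hρz (by
    have := hdet ρ 1 hρ (fun _ _ => rfl) e.symm
    rwa [one_smul] at this)
  -- Here `τ` fixes `z` but moves `a`, while `ρ` moves `z`. The amalgam makes `α τ` and `β ρ τ`
  -- agree at `a`, so they agree at `z`; but the former sends `z` to `z` and the latter sends it to
  -- `ρ z`.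
  obtain ⟨b, ⟨α, hα, hαb⟩, β, hβ, hβb⟩ := hF.amalgamation (S := S) (d := a) (d' := ρ.1 a)
    (e := τ.1 a) hρa
    (by
      rw [Finset.mem_insert, not_or]
      exact ⟨hτa, hnot τ hτ a ha⟩) ⟨ρ.2, hρ⟩
    (by
      rw [Finset.mem_insert, not_or]
      exact ⟨fun e => hτa (ρ.1.injective e), hnot ρ hρ _ (hnot τ hτ a ha)⟩)
  let α' : F.aut := ⟨α, hα.1⟩
  let β' : F.aut := ⟨β, hβ.1⟩
  have hα' : Fixes (insert a S) α' := hα.2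
  have hβ' : Fixes (insert (ρ.1 a) S) β' := hβ.2
  have hαS := hα'.mono (Finset.subset_insert _ _)
  have hβS := hβ'.mono (Finset.subset_insert _ _)
  have h1 : (α' * τ) • z = z := by rw [mul_smul, hτz, haS α' hα']
  have h2 : (β' * (ρ * τ)) • z = ρ • z := by
    rw [mul_smul, mul_smul, hτz, ← mul_smul]
    refine hdet _ _ (hβS.mul hρ) hρ ?_
    exact hβ' _ (Finset.mem_insert_self _ _)
  have h3 := hdet (α' * τ) (β' * (ρ * τ)) (hαS.mul hτ) (hβS.mul (hρ.mul hτ))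
    (hαb.trans hβb.symm)
  rw [h1, h2] at h3
  exact hρz h3.symm

theorem IsGeneric.rcfin (hF : F.IsGeneric) (hm : 0 < m) : (MOD F).RCfin m := by
  classical
  intro x hx
  obtain ⟨S₀, hS₀⟩ := exists_supportedBy x
  -- If `fix(S₀)` fixes all elements of `x`, every selection function commutes with it trivially.
  by_cases hall : ∀ z, (MOD F).mem z x → SupportedBy S₀ z
  · have hex : ∀ Z : Finset (MOD F).Obj, ∃ W, m < Z.card → W ⊆ Z ∧ W.card = m := fun Z => by
      by_cases h : m < Z.card
      · obtain ⟨W, hW⟩ := Finset.exists_subset_card_eq h.le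
        exact ⟨W, fun _ => hW⟩
      · exact ⟨∅, fun h' => absurd h' h⟩
    choose sel hsel using hex
    refine hasPartialSelection_of_sel (Y := (MOD F).ext x) (S := S₀) subset_rfl hx
      (fun π hπ y hy => by rwa [hall y hy π hπ]) sel fun Z hZ hc => ?_
    refine ⟨(hsel Z hc).1, (hsel Z hc).2, fun π hπ => ?_⟩
    have hid : ∀ W : Finset (MOD F).Obj, W ⊆ Z → W.map (MulAction.toPerm π).toEmbedding = W := by
      intro W hW
      rw [Finset.map_eq_image]
      exact (Finset.image_congr (g := id) fun w hw => hall w (hZ (hW hw)) π hπ).trans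
        Finset.image_id
    rw [hid Z subset_rfl, hid _ (hsel Z hc).1]
  push Not at hall
  obtain ⟨z, hzx, hz⟩ := hall
  obtain ⟨S, hS₀S, a, ha, hzS, hzaS⟩ := exists_supportedBy_insert hz
  -- `g` sends `π a` to `π z` and `k` sends `π z` to `π a`, for `π ∈ fix(S)`; the defaults off the
  -- two orbits never matter. `g` is well defined because `insert a S` supports `z`, and `k` by
  -- `IsGeneric.apply_eq_of_smul_eq`.
  let g : ℕ → (MOD F).Obj := fun c =>
    if h : ∃ π : F.aut, Fixes S π ∧ π.1 a = c then h.choose • z else z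
  let k : (MOD F).Obj → ℕ := fun w =>
    if h : ∃ π : F.aut, Fixes S π ∧ π • z = w then h.choose.1 a else 0
  have hk : ∀ π : F.aut, Fixes S π → k (π • z) = π.1 a := by
    intro π hπ
    have h : ∃ σ : F.aut, Fixes S σ ∧ σ • z = π • z := ⟨π, hπ, rfl⟩
    refine (dif_pos h).trans ?_
    exact hF.apply_eq_of_smul_eq ha hzS hzaS h.choose_spec.1 hπ h.choose_spec.2
  have hg : ∀ π : F.aut, Fixes S π → g (π.1 a) = π • z := by
    intro π hπ
    have h : ∃ σ : F.aut, Fixes S σ ∧ σ.1 a = π.1 a := ⟨π, hπ, rfl⟩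
    refine (dif_pos h).trans ?_
    rw [← inv_smul_eq_iff, ← mul_smul]
    refine hzaS _ fun b hb => ?_
    rcases Finset.mem_insert.1 hb with rfl | hb
    · change π.1⁻¹ (h.choose.1 b) = b
      rw [h.choose_spec.2]
      exact π.1.symm_apply_apply b
    · exact hπ.inv.mul h.choose_spec.1 b hb
  let Y : Set (MOD F).Obj := {w | ∃ π : F.aut, Fixes S π ∧ π • z = w}
  have hYx : Y ⊆ (MOD F).ext x := by
    rintro _ ⟨π, hπ, rfl⟩
    have := (mem_smul_smul_iff π).2 hzx
    rwa [hS₀ π (hπ.mono hS₀S)] at this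
  have hYinf : Y.Infinite := fun hfin => by
    refine hF.infinite_orbit hm ha ((hfin.image k).subset ?_)
    rintro _ ⟨π, hπ, rfl⟩
    exact ⟨π • z, ⟨π, hπ, rfl⟩, hk π hπ⟩
  have hgk : ∀ w ∈ Y, g (k w) = w := by
    rintro _ ⟨π, hπ, rfl⟩
    rw [hk π hπ, hg π hπ]
  have hYsmul : ∀ π : F.aut, Fixes S π → ∀ w ∈ Y, π • w ∈ Y := by
    rintro π hπ _ ⟨ρ, hρ, rfl⟩
    exact ⟨π * ρ, hπ.mul hρ, mul_smul _ _ _⟩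
  have hksmul : ∀ π : F.aut, Fixes S π → ∀ w ∈ Y, k (π • w) = π.1 (k w) := by
    rintro π hπ _ ⟨ρ, hρ, rfl⟩
    rw [← mul_smul, hk _ (hπ.mul hρ), hk _ hρ]
    rfl
  have hgsmul : ∀ π : F.aut, Fixes S π → ∀ w ∈ Y, g (π.1 (k w)) = π • g (k w) := by
    intro π hπ w hw
    rw [← hksmul π hπ w hw, hgk _ (hYsmul π hπ w hw), hgk w hw]
  -- Selection on the orbit of `z` is `F.sel` transported along `k` and `g`; it commutes with
  -- `fix(S)` because `F.sel`, `k` and `g` do on the orbits.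
  refine hasPartialSelection_of_sel hYx hYinf (S := S) hYsmul
    (fun Z => (F.sel (Z.image k)).image g) fun Z hZ hc => ?_
  have hkinj : Set.InjOn k Z := fun v hv w hw e => by
    rw [← hgk v (hZ hv), e, hgk w (hZ hw)]
  have hc' : m < (Z.image k).card := by rwa [Finset.card_image_of_injOn hkinj]
  have hsub := F.sel_subset _ hc'
  refine ⟨fun v hv => ?_, ?_, fun π hπ => ?_⟩
  · obtain ⟨c, hcsel, rfl⟩ := Finset.mem_image.1 hv
    obtain ⟨w, hw, rfl⟩ := Finset.mem_image.1 (hsub hcsel)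
    rwa [hgk w (hZ hw)]
  · rw [Finset.card_image_of_injOn, F.card_sel _ hc']
    intro c hcsel d hdsel e
    obtain ⟨v, hv, rfl⟩ := Finset.mem_image.1 (hsub (Finset.mem_coe.1 hcsel))
    obtain ⟨w, hw, rfl⟩ := Finset.mem_image.1 (hsub (Finset.mem_coe.1 hdsel))
    rw [hgk v (hZ hv), hgk w (hZ hw)] at e
    rw [e]
  · have h1 : (Z.map (MulAction.toPerm π).toEmbedding).image k =
        (Z.image k).map π.1.toEmbedding := by
      rw [Finset.map_eq_image, Finset.map_eq_image, Finset.image_image, Finset.image_image]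
      exact Finset.image_congr fun w hw => hksmul π hπ w (hZ hw)
    rw [h1, π.2 _ hc', Finset.map_eq_image, Finset.map_eq_image, Finset.image_image,
      Finset.image_image]
    refine Finset.image_congr fun c hcsel => ?_
    obtain ⟨w, hw, rfl⟩ := Finset.mem_image.1 (hsub (Finset.mem_coe.1 hcsel))
    exact hgsmul π hπ w (hZ hw)

end SelModel

theorem mainTheorem3 (m n : ℕ) (hm : 0 < m) (hmn : m < n) (hdvd : ¬ m ∣ n) :
    -- the generic model of `T_m`, on which `MOD_m` is built, exists
    (∃ F : SelModel m ℕ, F.IsGeneric) ∧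
    ∀ F : SelModel m ℕ, F.IsGeneric →
      -- `nRC_fin` fails in `MOD_m`
      ¬ (MOD F).RCfin n ∧
      -- it fails on the set of atoms
      ¬ (MOD F).HasPartialSelection n (permutationModel.atoms F.aut) ∧
      -- every infinite set `Y` of atoms with finite support `S` contains, outside `S`, arbitrarily
      -- many disjoint `m`-cycles of one automorphism that fixes `S` pointwise
      (∀ (S : Finset ℕ) (Y : Set ℕ), Y.Infinite →
        (∀ π ∈ AtomSet.fixing F.aut (S : Set ℕ), π '' Y = Y) →
        ∀ k : ℕ, ∃ c : Fin k × ZMod m → ℕ, Function.Injective c ∧ Set.range c ⊆ Y \ (S : Set ℕ) ∧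
          ∃ π ∈ AtomSet.fixing F.aut (S : Set ℕ), ∀ i j, π (c (i, j)) = c (i, j + 1)) ∧
      -- `mRC_fin` holds in `MOD_m`, so that `mRC_fin` does not imply `nRC_fin`
      (MOD F).RCfin m := by
  refine ⟨SelModel.exists_isGeneric m, fun F hF => ?_⟩
  have hatoms := hF.not_hasPartialSelection_atoms hm hdvd
  exact ⟨fun h => hatoms (h _ permutationModel.infinite_ext_atoms), hatoms,
    fun S Y hinf hY k => hF.exists_cycles_mem hm S hinf hY k, hF.rcfin hm⟩
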